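/- For $r$ in a field of characteristic $0$ let $E_r$ be Kubert's curve $y^2=f_r(x)$, $f_r(x)=x^3+(r^2-6r+1)x^2+8r(r-1)x+16r^2$. When $r=R/D$, write $x=u/D^2$ for the coordinate change that clears denominators, $v^2=u^3+(R^2-6RD+D^2)u^2+8R(R-D)D^2u+16R^2D^4$. Consider the following two solutions. **Solution 1.** $r=\dfrac{3k^2-12}{k^2-1}$, $k=\dfrac{(s-1)^2}{s^2-17}$, $s=\dfrac{5t^2-40t+131}{t^2-33}$, with $x_1=\dfrac{-12r}{r-3}$, $\ x_2=\dfrac{4(k^2-4)(k-1)^2}{(k^2-1)^2}$, $\ x_3=\dfrac{-16(s-5)(s+3)(s+7)(3s-11)(s^2-s-8)^2}{\big((k^2-1)(s^2-17)^2\big)^2}$. **Solution 2.** $r=\dfrac{k^2-144}{3(k^2-36)}$, $k=\dfrac{12(s^2-18s+81)}{s^2-41}$, $s=\dfrac{t^2-412t-2213}{3t^2-3}$, with $x_1=\dfrac{4r}{1-3r}$, $\ x_2=\dfrac{4(k-6)^2(k^2-144)}{(3(k^2-36))^2}$, $\ x_3=\dfrac{-82944(s-4)(s-5)(9s-61)(3s^2-36s+121)^2}{\big(3(k^2-36)(s^2-41)^2\big)^2}$.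 (a) *Three successive conics.* In $\mathbb{Q}(r)$, $\mathbb{Q}(k)$, $\mathbb{Q}(s)$ respectively, $f_r(x_1)$, $f_{r(k)}(x_2)$, $f_{r(k(s))}(x_3)$ are equal to a square times a quadratic, namely $(r-3)(r-12)$, $\ 17k^2-16k$, $\ 33s^2-34s-255$ for Solution 1, and $(3r-1)(3r-4)$, $\ 41k^2+480k$, $\ s^2-738s+4961$ for Solution 2. The displayed formulas parametrize the corresponding conics: a rational number $r$ (with $r\ne 3$, resp. $r\neq 1/3$) makes the first quadratic a rational square if and only if $r=r(k)$ for some $k\in\mathbb{Q}$ at which the denominator does not vanish; likewise for all rational $k$ and $k(s)$, and for all rational $s$ and $s(t)$. (b) *The family.* In either solution, with $r,x_1,x_2,x_3$ regarded as elements of $\mathbb{Q}(t)$, $E_r$ is an elliptic curve over $\mathbb{Q}(t)$ whose torsion subgroup $E_r(\mathbb{Q}(t))_{\rm tors}$ is isomorphic to $\mathbb{Z}/5\mathbb{Z}$, and there are linearly independent points of $E_r(\mathbb{Q}(t))$ with $x$-coordinates $x_1,x_2,x_3$; in particular the rank over $\mathbb{Q}(t)$ is at least $3$. (c) *Its members.*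 In either solution, for every $t\in\mathbb{Q}$ for which all denominators in the formulas are nonzero and $r\neq 0$, $E_{r}$ is an elliptic curve over $\mathbb{Q}$, $E_r(\mathbb{Q})$ has a subgroup isomorphic to $\mathbb{Z}/5\mathbb{Z}$, and $x_1,x_2,x_3$ are $x$-coordinates of rational points. Moreover, such members with torsion subgroup exactly $\mathbb{Z}/5\mathbb{Z}$ on which the three points are linearly independent (so that the rank is at least $3$) attain infinitely many different $j$-invariants. -/

import Mathlib

/-- Kubert's curve `y² = x³ + (r² - 6r + 1)x² + 8r(r - 1)x + 16r²` over a field. -/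
def kubertCurve {K : Type*} [Field K] (r : K) : WeierstrassCurve.Affine K where
  a₁ := 0
  a₂ := r ^ 2 - 6 * r + 1
  a₃ := 0
  a₄ := 8 * r * (r - 1)
  a₆ := 16 * r ^ 2

/-- The cubic in `x` on the right-hand side of the equation of `kubertCurve r`. -/
def kubertCubic {K : Type*} [Field K] (r x : K) : K :=
  x ^ 3 + (r ^ 2 - 6 * r + 1) * x ^ 2 + 8 * r * (r - 1) * x + 16 * r ^ 2

/-- The group of `K`-rational points has torsion subgroup isomorphic to `ℤ/5ℤ`. -/
def TorsionIsZMod5 {K : Type*} [Field K] [DecidableEq K] (W : WeierstrassCurve.Affine K) : Prop :=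
  Nonempty (AddCommGroup.torsion W.Point ≃+ ZMod 5)

/-- `P` is an affine point with first coordinate `x`. -/
def HasXCoord {K : Type*} [Field K] {W : WeierstrassCurve.Affine K} (P : W.Point) (x : K) : Prop :=
  ∃ (y : K) (h : W.Nonsingular x y), P = WeierstrassCurve.Affine.Point.some x y h

/-- There are `K`-rational points with `x`-coordinates `x 0, x 1, x 2` that are linearly
independent over `ℤ` in the group of `K`-rational points. -/
def HasIndependentPoints {K : Type*} [Field K] [DecidableEq K] (W : WeierstrassCurve.Affine K)
    (x : Fin 3 → K) : Prop :=
  ∃ P : Fin 3 → W.Point, (∀ i, HasXCoord (P i) (x i)) ∧ LinearIndependent ℤ P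

/-- As a function of its parameter `X`, `f` is a square in `ℚ(X)` times the quadratic
polynomial `a X² + b X + c`. -/
def IsSquareTimesQuadratic (f : RatFunc ℚ) (a b c : ℚ) : Prop :=
  ∃ F : RatFunc ℚ, f = F ^ 2 *
    (RatFunc.C a * RatFunc.X ^ 2 + RatFunc.C b * RatFunc.X + RatFunc.C c)

/-- `p / q` parametrizes the conic `a v² + b v + c = d²`: a rational number `v` outside `S` makes
the quadratic a rational square exactly when it is a value of `p / q` at a rational number. -/
def ParametrizesConic (a b c : ℚ) (S : Set ℚ) (p q : ℚ → ℚ) : Prop :=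
  ∀ v : ℚ, v ∉ S →
    ((∃ d : ℚ, a * v ^ 2 + b * v + c = d ^ 2) ↔ ∃ w : ℚ, q w ≠ 0 ∧ v = p w / q w)

/-- The curve with parameter `r ∈ ℚ(t)` is an elliptic curve over `ℚ(t)` with torsion subgroup
`ℤ/5ℤ` and rank at least `3`, and `x 0, x 1, x 2` are `x`-coordinates of independent points. -/
def IsGenericRankThreeFamily [DecidableEq (RatFunc ℚ)] (r : RatFunc ℚ) (x : Fin 3 → RatFunc ℚ) :
    Prop :=
  (kubertCurve r).IsElliptic ∧
  TorsionIsZMod5 (kubertCurve r) ∧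
  HasIndependentPoints (kubertCurve r) x ∧
  3 ≤ Module.rank ℤ (kubertCurve r).Point

/-- Every admissible member is an elliptic curve over `ℚ` with a subgroup `ℤ/5ℤ` of rational
points and with rational points at the prescribed `x`-coordinates. -/
def EveryMemberHasPoints (adm : ℚ → Prop) (r : ℚ → ℚ) (x : ℚ → Fin 3 → ℚ) : Prop :=
  ∀ t : ℚ, adm t →
    (kubertCurve (r t)).IsElliptic ∧
    (∃ φ : ZMod 5 →+ (kubertCurve (r t)).Point, Function.Injective φ) ∧
    ∀ i, ∃ P : (kubertCurve (r t)).Point, HasXCoord P (x t i)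

/-- There are members with infinitely many different `j`-invariants whose rational torsion
subgroup is exactly `ℤ/5ℤ`, whose rank is at least `3`, and on which the three prescribed points
are independent. -/
def InfinitelyManyRankThreeMembers (adm : ℚ → Prop) (r : ℚ → ℚ) (x : ℚ → Fin 3 → ℚ) : Prop :=
  {j : ℚ | ∃ t : ℚ, adm t ∧ ∃ hE : (kubertCurve (r t)).IsElliptic,
    j = @WeierstrassCurve.j ℚ _ (kubertCurve (r t)) hE ∧
    TorsionIsZMod5 (kubertCurve (r t)) ∧
    HasIndependentPoints (kubertCurve (r t)) (x t) ∧
    3 ≤ Module.rank ℤ (kubertCurve (r t)).Point}.Infinite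

namespace SolutionOne

section
variable {K : Type*} [Field K]

/-- The first `x`-coordinate, on the curve with parameter `r`. -/
def x (r : K) : K := -12 * r / (r - 3)
def rNum (k : K) : K := 3 * k ^ 2 - 12
def rDen (k : K) : K := k ^ 2 - 1
def r (k : K) : K := rNum k / rDen k
def u (k : K) : K := 4 * (k ^ 2 - 4) * (k - 1) ^ 2
/-- The second `x`-coordinate: with `r = R / D`, the coordinate on the model with cleared
denominators `v² = u³ + (R² - 6RD + D²)u² + 8R(R - D)D²u + 16R²D⁴` is `u = D² x`. -/
def xOfU (k : K) : K := u k / rDen k ^ 2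
def kNum (s : K) : K := (s - 1) ^ 2
def kDen (s : K) : K := s ^ 2 - 17
def k (s : K) : K := kNum s / kDen s
def h (s : K) : K :=
  -16 * (s - 5) * (s + 3) * (s + 7) * (3 * s - 11) * (s ^ 2 - s - 8) ^ 2
/-- The denominator of `r (k s)` as a polynomial in `s`, that is, `(k² - 1)(s² - 17)²`. -/
def rDenOfS (s : K) : K := kNum s ^ 2 - kDen s ^ 2
/-- The third `x`-coordinate: again `h = D² x` on the model with cleared denominators. -/
def xOfH (s : K) : K := h s / rDenOfS s ^ 2
def sNum (t : K) : K := 5 * t ^ 2 - 40 * t + 131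
def sDen (t : K) : K := t ^ 2 - 33
def s (t : K) : K := sNum t / sDen t

/-- The parameter of the curve as a function of `t`. -/
def rOfT (t : K) : K := r (k (s t))
/-- The three `x`-coordinates as functions of `t`. -/
def xs (t : K) : Fin 3 → K := ![x (rOfT t), xOfU (k (s t)), xOfH (s t)]

/-- All denominators are nonzero, and `r ≠ 0`. -/
def Admissible (t : K) : Prop :=
  sDen t ≠ 0 ∧ kDen (s t) ≠ 0 ∧ rDen (k (s t)) ≠ 0 ∧ rOfT t - 3 ≠ 0 ∧ rOfT t ≠ 0
end

end SolutionOne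

namespace SolutionTwo

section
variable {K : Type*} [Field K]

/-- The first `x`-coordinate, on the curve with parameter `r`. -/
def x (r : K) : K := 4 * r / (1 - 3 * r)
def rNum (k : K) : K := k ^ 2 - 144
def rDen (k : K) : K := 3 * (k ^ 2 - 36)
def r (k : K) : K := rNum k / rDen k
def u (k : K) : K := 4 * (k - 6) ^ 2 * (k ^ 2 - 144)
/-- The second `x`-coordinate: with `r = R / D`, the coordinate on the model with cleared
denominators `v² = u³ + (R² - 6RD + D²)u² + 8R(R - D)D²u + 16R²D⁴` is `u = D² x`. -/
def xOfU (k : K) : K := u k / rDen k ^ 2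
def kNum (s : K) : K := 12 * (s ^ 2 - 18 * s + 81)
def kDen (s : K) : K := s ^ 2 - 41
def k (s : K) : K := kNum s / kDen s
def h (s : K) : K :=
  -82944 * (s - 4) * (s - 5) * (9 * s - 61) * (3 * s ^ 2 - 36 * s + 121) ^ 2
/-- The denominator of `r (k s)` as a polynomial in `s`, that is, `3(k² - 36)(s² - 41)²`. -/
def rDenOfS (s : K) : K := 3 * (kNum s ^ 2 - 36 * kDen s ^ 2)
/-- The third `x`-coordinate: again `h = D² x` on the model with cleared denominators. -/
def xOfH (s : K) : K := h s / rDenOfS s ^ 2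
def sNum (t : K) : K := t ^ 2 - 412 * t - 2213
def sDen (t : K) : K := 3 * t ^ 2 - 3
def s (t : K) : K := sNum t / sDen t

/-- The parameter of the curve as a function of `t`. -/
def rOfT (t : K) : K := r (k (s t))
/-- The three `x`-coordinates as functions of `t`. -/
def xs (t : K) : Fin 3 → K := ![x (rOfT t), xOfU (k (s t)), xOfH (s t)]

/-- All denominators are nonzero, and `r ≠ 0`. -/
def Admissible (t : K) : Prop :=
  sDen t ≠ 0 ∧ kDen (s t) ≠ 0 ∧ rDen (k (s t)) ≠ 0 ∧ 1 - 3 * rOfT t ≠ 0 ∧ rOfT t ≠ 0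
end

end SolutionTwo

/-!
Everything is reduced to congruences on the parameter `t`, read off after embedding the base field
`K`, which is `ℚ` or `ℚ(t)`, into suitable fields `ℚ_p`. An embedding of `ℚ(t)` sends `t` to a
`p`-adic number that is transcendental over `ℚ` and lies in the prescribed residue class
(`exists_ratFunc_embedding`), so that the generic statement and the statement about infinitely many
members have the same proof (`members_of_congruences`, once for each solution).

*Torsion.* Substituting `x = 4X`, `y = 4(2Y + (1 - r)X - r)` turns the curve into
`Y² + (1 - r)XY - rY = X³ - rX²`, which has good reduction at `2` with exactly five points when `r`
is a 2-adic unit. Accordingly the torsion subgroup is then `ℤ/5ℤ` (`torsionIsZMod5_of_padic_unit`).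
No formal group is needed. If `x` is not divisible by `4`, then doubling multiplies `‖x‖₂` by
exactly `4`, so the point has infinite order (`padic_norm_x_le_of_torsion`). If `x` is divisible
by `4`, it is congruent modulo `8` to the `x`-coordinate of one of the points `± T`, `± 2T` with
`T = (0, 4r)`, and adding one of these to the point gives a point of the first kind, unless the
point is one of them (`eq_or_eq_neg_of_torsion`).

*Independence.* For a root `θ` of the cubic in an extension `L` of `K` that is not in `K`, the
points with `x - θ` a square in `L` form a subgroup that contains all doubles (`descentSubgroup`),
because `(x(P) - θ)(x(Q) - θ)(x(P + Q) - θ)` is a square by the chord and tangent construction.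
With `L = ℚ_p` for an odd prime `p` and `θ` the Hensel lift of a simple root modulo `p`, membership
depends only on the residue class of `x` (`exists_descent_subgroup`). Three subgroups of this kind
that separate the three points in a triangular way, together with the absence of 2-torsion, give
linear independence by infinite descent (`linearIndependent_of_subgroups`).

*Infinitely many `j`-invariants.* The maps `t ↦ s ↦ k ↦ r ↦ j` have finite fibres, and the required
congruences hold on an arithmetic progression.

The statements on the conics are explicit identities: in each step `s`, say, is a solution of a
quadratic equation over `ℚ(k)` whose discriminant is, up to a square, the quadratic polynomial in
question.
-/

/-! ### The group law on Kubert's curve -/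

section GroupLaw

variable {K : Type*} [Field K] {r : K}

open WeierstrassCurve.Affine

lemma kubertCurve_equation_iff {x y : K} :
    (kubertCurve r).Equation x y ↔ y ^ 2 = kubertCubic r x := by
  rw [equation_iff]
  simp [kubertCurve, kubertCubic]

lemma kubertCurve_negY (x y : K) : (kubertCurve r).negY x y = -y := by
  simp [negY, kubertCurve]

lemma kubertCurve_Δ (r : K) :
    WeierstrassCurve.Δ (kubertCurve r) = 2 ^ 12 * r ^ 5 * (r ^ 2 - 11 * r - 1) := by
  simp only [WeierstrassCurve.Δ, WeierstrassCurve.b₂, WeierstrassCurve.b₄, WeierstrassCurve.b₆,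
    WeierstrassCurve.b₈, kubertCurve]
  ring

lemma kubertCurve_c₄ (r : K) :
    WeierstrassCurve.c₄ (kubertCurve r) =
      16 * (r ^ 4 - 12 * r ^ 3 + 14 * r ^ 2 + 12 * r + 1) := by
  simp only [WeierstrassCurve.c₄, WeierstrassCurve.b₂, WeierstrassCurve.b₄, kubertCurve]
  ring

lemma kubertCurve_isElliptic [CharZero K] (hr : r ≠ 0) (hr' : r ^ 2 - 11 * r - 1 ≠ 0) :
    (kubertCurve r).IsElliptic := by
  rw [WeierstrassCurve.isElliptic_iff, kubertCurve_Δ, isUnit_iff_ne_zero]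
  exact mul_ne_zero (mul_ne_zero (by norm_num) (pow_ne_zero _ hr)) hr'

lemma exists_hasXCoord [(kubertCurve r).IsElliptic] {x : K} (h : IsSquare (kubertCubic r x)) :
    ∃ P : (kubertCurve r).Point, HasXCoord P x := by
  obtain ⟨y, hy⟩ := h
  have : (kubertCurve r).Equation x y := kubertCurve_equation_iff.2 (by rw [hy, sq])
  exact ⟨_, y, equation_iff_nonsingular.1 this, rfl⟩

variable [DecidableEq K]

/-- The chord construction with explicit coordinates. -/
lemma exists_add_of_X_ne {x₁ y₁ x₂ y₂ : K} (h₁ : (kubertCurve r).Nonsingular x₁ y₁)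
    (h₂ : (kubertCurve r).Nonsingular x₂ y₂) (hx : x₁ ≠ x₂) :
    ∃ (y₃ : K) (h₃ : (kubertCurve r).Nonsingular
        (((y₁ - y₂) / (x₁ - x₂)) ^ 2 - (r ^ 2 - 6 * r + 1) - x₁ - x₂) y₃),
      Point.some x₁ y₁ h₁ + Point.some x₂ y₂ h₂ = Point.some _ y₃ h₃ := by
  have key := Point.add_of_X_ne (h₁ := h₁) (h₂ := h₂) hx
  have e : (kubertCurve r).addX x₁ x₂ ((kubertCurve r).slope x₁ x₂ y₁ y₂) =
      ((y₁ - y₂) / (x₁ - x₂)) ^ 2 - (r ^ 2 - 6 * r + 1) - x₁ - x₂ := by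
    rw [slope_of_X_ne hx, addX]
    simp [kubertCurve]
  have h := nonsingular_add h₁ h₂ (fun hxy => hx hxy.left)
  refine ⟨_, e ▸ h, ?_⟩
  rw [key]
  simp only [e]

/-- The tangent construction with explicit coordinates. -/
lemma exists_two_nsmul [CharZero K] {x y : K} (h : (kubertCurve r).Nonsingular x y) (hy : y ≠ 0)
    {ℓ x' y' : K} (hℓ : 2 * y * ℓ = 3 * x ^ 2 + 2 * (r ^ 2 - 6 * r + 1) * x + 8 * r * (r - 1))
    (hx' : x' = ℓ ^ 2 - (r ^ 2 - 6 * r + 1) - 2 * x) (hy' : y' = -(y + ℓ * (x' - x))) :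
    ∃ h' : (kubertCurve r).Nonsingular x' y',
      (2 : ℕ) • Point.some x y h = Point.some x' y' h' := by
  have hyn : y ≠ (kubertCurve r).negY x y := by
    rw [kubertCurve_negY]
    intro e
    apply hy
    linear_combination (1 / 2 : K) * e
  have key := Point.add_self_of_Y_ne (h₁ := h) hyn
  have hs : (kubertCurve r).slope x x y y = ℓ := by
    rw [slope_of_Y_ne rfl hyn, kubertCurve_negY, div_eq_iff (by
      rw [sub_neg_eq_add, ← two_mul]; exact mul_ne_zero two_ne_zero hy)]
    simp only [kubertCurve]
    linear_combination -hℓ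
  have e : (kubertCurve r).addX x x ((kubertCurve r).slope x x y y) = x' := by
    rw [hs, addX, hx']
    simp only [kubertCurve]
    ring
  have e' : (kubertCurve r).addY x x y ((kubertCurve r).slope x x y y) = y' := by
    rw [addY, negAddY, e, hs, kubertCurve_negY, hy']
    ring
  have hn := nonsingular_add h h (fun hxy => hyn hxy.right)
  refine ⟨e ▸ e' ▸ hn, ?_⟩
  rw [two_nsmul, key]
  simp only [e, e']

/-- If `P + Q = R`, the chord or tangent through `P` and `Q` shows that
`(x(P) - θ)(x(Q) - θ)(x(R) - θ)` is a square for every root `θ` of the cubic, in any extension. -/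
lemma isSquare_prod_sub_root {L : Type*} [Field L] (ι : K →+* L) {θ : L}
    (hθ : kubertCubic (ι r) θ = 0) {x₁ y₁ x₂ y₂ x₃ y₃ : K}
    (h₁ : (kubertCurve r).Nonsingular x₁ y₁) (h₂ : (kubertCurve r).Nonsingular x₂ y₂)
    (h₃ : (kubertCurve r).Nonsingular x₃ y₃)
    (h : Point.some x₁ y₁ h₁ + Point.some x₂ y₂ h₂ = Point.some x₃ y₃ h₃) :
    IsSquare ((ι x₁ - θ) * (ι x₂ - θ) * (ι x₃ - θ)) := by
  have hxy : ¬(x₁ = x₂ ∧ y₁ = (kubertCurve r).negY x₂ y₂) := by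
    rintro ⟨hx, hy⟩
    rw [Point.add_of_Y_eq hx hy] at h
    exact Point.some_ne_zero _ h.symm
  rw [Point.add_some hxy] at h
  obtain ⟨hx, -⟩ := (Point.some.injEq ..).mp h
  have key := addPolynomial_slope h₁.left h₂.left hxy
  rw [hx, addPolynomial_eq] at key
  generalize (kubertCurve r).slope x₁ x₂ y₁ y₂ = ℓ at key
  have key' := congrArg (Polynomial.eval₂ ι θ) key
  simp only [Cubic.toPoly, Polynomial.eval₂_neg, Polynomial.eval₂_add, Polynomial.eval₂_mul,
    Polynomial.eval₂_sub, Polynomial.eval₂_pow, Polynomial.eval₂_one, Polynomial.eval₂_zero,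
    Polynomial.eval₂_ofNat, Polynomial.eval₂_X, Polynomial.eval₂_C,
    kubertCurve, map_add, map_sub, map_mul, map_neg, map_pow, map_one, map_zero,
    map_ofNat] at key'
  refine ⟨ι y₁ + ι ℓ * (θ - ι x₁), ?_⟩
  rw [kubertCubic] at hθ
  linear_combination -key' - hθ

end GroupLaw

/-! ### The rational subgroup of order five -/

section FiveTorsion

variable {K : Type*} [Field K] {r : K} [(kubertCurve r).IsElliptic]

open WeierstrassCurve.Affine

/-- The point `(0, 4r)` of order five on Kubert's curve. -/
def kubertPoint (r : K) [(kubertCurve r).IsElliptic] : (kubertCurve r).Point :=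
  Point.some 0 (4 * r) <| equation_iff_nonsingular.1 <| kubertCurve_equation_iff.2 <| by
    rw [kubertCubic]; ring

lemma kubertPoint_ne_zero : kubertPoint r ≠ 0 := Point.some_ne_zero _

variable (r) in
lemma ne_zero_of_isElliptic : r ≠ 0 := by
  have h := (WeierstrassCurve.isElliptic_iff (kubertCurve r)).1 inferInstance
  rw [kubertCurve_Δ] at h
  rintro rfl
  simp at h

variable [DecidableEq K] [CharZero K]

lemma two_nsmul_kubertPoint :
    ∃ h : (kubertCurve r).Nonsingular (4 * r) (-4 * r ^ 2),
      (2 : ℕ) • kubertPoint r = Point.some (4 * r) (-4 * r ^ 2) h := by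
  have hr := ne_zero_of_isElliptic r
  exact exists_two_nsmul _ (by simpa using hr) (ℓ := r - 1) (by ring) (by ring) (by ring)

lemma four_nsmul_kubertPoint : (4 : ℕ) • kubertPoint r = -kubertPoint r := by
  have hr := ne_zero_of_isElliptic r
  obtain ⟨h, e⟩ := two_nsmul_kubertPoint (r := r)
  obtain ⟨h', e'⟩ := exists_two_nsmul h (by simpa using hr) (ℓ := -(r + 1)) (x' := 0)
    (y' := -(4 * r)) (by ring) (by ring) (by ring)
  rw [show 4 = 2 * 2 from rfl, mul_nsmul, e, e', kubertPoint, Point.neg_some]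
  simp only [kubertCurve_negY]

lemma five_nsmul_kubertPoint : (5 : ℕ) • kubertPoint r = 0 := by
  rw [succ_nsmul, four_nsmul_kubertPoint, neg_add_cancel]

/-- The embedding of `ℤ/5ℤ` that sends `1` to `(0, 4r)`. -/
def kubertHom (r : K) [(kubertCurve r).IsElliptic] : ZMod 5 →+ (kubertCurve r).Point :=
  ZMod.lift 5 ⟨zmultiplesHom _ (kubertPoint r), by
    rw [zmultiplesHom_apply, natCast_zsmul, five_nsmul_kubertPoint]⟩

lemma kubertHom_intCast (n : ℤ) : kubertHom r n = n • kubertPoint r := by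
  simp [kubertHom]

variable (r) in
lemma kubertHom_injective : Function.Injective (kubertHom r) := by
  have key : kubertHom r 1 ≠ 0 := by
    have := kubertHom_intCast (r := r) 1
    simp only [Int.cast_one, one_smul] at this
    rw [this]
    exact kubertPoint_ne_zero
  rw [injective_iff_map_eq_zero]
  intro a ha
  by_contra h
  apply key
  have : Fact (Nat.Prime 5) := ⟨by norm_num⟩
  have : a⁻¹.val • kubertHom r a = kubertHom r 1 := by
    rw [← map_nsmul, nsmul_eq_mul, ZMod.natCast_zmod_val, inv_mul_cancel₀ h]
  rw [← this, ha, smul_zero]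

/-- If every torsion point is a multiple of `(0, 4r)`, the torsion subgroup is `ℤ/5ℤ`. -/
lemma torsionIsZMod5_of_forall_mem_range
    (h : ∀ P : (kubertCurve r).Point, IsOfFinAddOrder P → P ∈ (kubertHom r).range) :
    TorsionIsZMod5 (kubertCurve r) := by
  have e : AddCommGroup.torsion (kubertCurve r).Point = (kubertHom r).range := by
    ext P
    refine ⟨h P, ?_⟩
    rintro ⟨a, rfl⟩
    refine isOfFinAddOrder_iff_nsmul_eq_zero.2 ⟨5, by norm_num, ?_⟩
    rw [← map_nsmul, nsmul_eq_mul]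
    have h5 : ((5 : ℕ) : ZMod 5) = 0 := by decide
    rw [h5, zero_mul, map_zero]
  rw [TorsionIsZMod5, e]
  exact ⟨(AddMonoidHom.ofInjective (kubertHom_injective r)).symm⟩

end FiveTorsion

/-! ### Reduction of p-adic numbers -/

section Reduction

variable {p : ℕ} [Fact p.Prime]

/-- The `p`-adic number `x` is integral, with residue class `a` modulo `p`. -/
def ReducesTo (x : ℚ_[p]) (a : ZMod p) : Prop :=
  ∃ z : ℤ_[p], (z : ℚ_[p]) = x ∧ PadicInt.toZMod z = a

lemma padicInt_toZMod_eq_zero_iff {z : ℤ_[p]} : PadicInt.toZMod z = 0 ↔ ‖z‖ < 1 := by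
  rw [← RingHom.mem_ker, PadicInt.ker_toZMod, IsLocalRing.mem_maximalIdeal, PadicInt.mem_nonunits]

namespace ReducesTo

variable {x y : ℚ_[p]} {a b : ZMod p}

lemma norm_le_one (hx : ReducesTo x a) : ‖x‖ ≤ 1 := by
  obtain ⟨z, rfl, -⟩ := hx
  exact z.norm_le_one

lemma norm_lt_one_iff (hx : ReducesTo x a) : ‖x‖ < 1 ↔ a = 0 := by
  obtain ⟨z, rfl, rfl⟩ := hx
  rw [padicInt_toZMod_eq_zero_iff, PadicInt.padic_norm_e_of_padicInt]

lemma norm_eq_one (hx : ReducesTo x a) (ha : a ≠ 0) : ‖x‖ = 1 :=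
  le_antisymm hx.norm_le_one (not_lt.1 (mt hx.norm_lt_one_iff.1 ha))

lemma ne_zero (hx : ReducesTo x a) (ha : a ≠ 0) : x ≠ 0 := by
  rintro rfl
  exact ha (hx.norm_lt_one_iff.1 (by simp))

lemma of_norm_le_one (hx : ‖x‖ ≤ 1) : ∃ a : ZMod p, ReducesTo x a :=
  ⟨_, ⟨x, hx⟩, rfl, rfl⟩

lemma unique (hx : ReducesTo x a) (hx' : ReducesTo x b) : a = b := by
  obtain ⟨z, rfl, rfl⟩ := hx
  obtain ⟨z', h, rfl⟩ := hx'
  rw [PadicInt.ext h]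

lemma add (hx : ReducesTo x a) (hy : ReducesTo y b) : ReducesTo (x + y) (a + b) := by
  obtain ⟨z, rfl, rfl⟩ := hx
  obtain ⟨w, rfl, rfl⟩ := hy
  exact ⟨z + w, by simp, by simp⟩

lemma sub (hx : ReducesTo x a) (hy : ReducesTo y b) : ReducesTo (x - y) (a - b) := by
  obtain ⟨z, rfl, rfl⟩ := hx
  obtain ⟨w, rfl, rfl⟩ := hy
  exact ⟨z - w, by simp, by simp⟩

lemma mul (hx : ReducesTo x a) (hy : ReducesTo y b) : ReducesTo (x * y) (a * b) := by
  obtain ⟨z, rfl, rfl⟩ := hx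
  obtain ⟨w, rfl, rfl⟩ := hy
  exact ⟨z * w, by simp, by simp⟩

lemma neg (hx : ReducesTo x a) : ReducesTo (-x) (-a) := by
  obtain ⟨z, rfl, rfl⟩ := hx
  exact ⟨-z, by simp, by simp⟩

lemma pow (hx : ReducesTo x a) (n : ℕ) : ReducesTo (x ^ n) (a ^ n) := by
  obtain ⟨z, rfl, rfl⟩ := hx
  exact ⟨z ^ n, by simp, by simp⟩

lemma natCast (n : ℕ) : ReducesTo (n : ℚ_[p]) n := ⟨n, by simp, by simp⟩

lemma ofNat (n : ℕ) [n.AtLeastTwo] : ReducesTo (OfNat.ofNat n : ℚ_[p]) (OfNat.ofNat n) :=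
  natCast n

lemma one : ReducesTo (1 : ℚ_[p]) 1 := ⟨1, by simp, by simp⟩

lemma div (hx : ReducesTo x a) (hy : ReducesTo y b) (hb : b ≠ 0) : ReducesTo (x / y) (a / b) := by
  have h := hy.norm_eq_one hb
  obtain ⟨c, hc⟩ := of_norm_le_one (x := x / y) (by rw [norm_div, h, div_one]; exact hx.norm_le_one)
  have e : c = a / b := by
    rw [eq_div_iff hb]
    exact (hc.mul hy).unique (by rwa [div_mul_cancel₀ _ (hy.ne_zero hb)])
  exact e ▸ hc

/-- A simple root modulo `p` of Kubert's cubic lifts to `ℚ_p`. -/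
lemma exists_kubertCubic_root (hx : ReducesTo x a) (h : kubertCubic a b = 0)
    (h' : 3 * b ^ 2 + 2 * (a ^ 2 - 6 * a + 1) * b + 8 * a * (a - 1) ≠ 0) :
    ∃ θ : ℚ_[p], ReducesTo θ b ∧ kubertCubic x θ = 0 := by
  obtain ⟨r, rfl, rfl⟩ := hx
  obtain ⟨b₀, rfl⟩ := ZMod.ringHom_surjective PadicInt.toZMod b
  obtain ⟨A, hA⟩ : ∃ A, A = r ^ 2 - 6 * r + 1 := ⟨_, rfl⟩
  obtain ⟨B, hB⟩ : ∃ B, B = 8 * r * (r - 1) := ⟨_, rfl⟩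
  obtain ⟨C, hC⟩ : ∃ C, C = 16 * r ^ 2 := ⟨_, rfl⟩
  let F : Polynomial ℤ_[p] := Polynomial.X ^ 3 + Polynomial.C A * Polynomial.X ^ 2 +
    Polynomial.C B * Polynomial.X + Polynomial.C C
  have hF : ∀ z : ℤ_[p], Polynomial.aeval z F =
      z ^ 3 + (r ^ 2 - 6 * r + 1) * z ^ 2 + 8 * r * (r - 1) * z + 16 * r ^ 2 := by
    intro z
    simp [F, hA, hB, hC]
  have hF' : Polynomial.aeval b₀ (Polynomial.derivative F) =
      3 * b₀ ^ 2 + 2 * (r ^ 2 - 6 * r + 1) * b₀ + 8 * r * (r - 1) := by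
    simp only [F, Polynomial.derivative_add, Polynomial.derivative_mul, Polynomial.derivative_C,
      Polynomial.derivative_X_pow, Polynomial.derivative_X, Polynomial.coe_aeval_eq_eval]
    simp [hA, hB]
    ring
  have h1 : ‖Polynomial.aeval b₀ (Polynomial.derivative F)‖ = 1 := by
    refine le_antisymm (PadicInt.norm_le_one _) (not_lt.1 (mt padicInt_toZMod_eq_zero_iff.2 ?_))
    rw [hF']
    simpa only [map_add, map_sub, map_mul, map_pow, map_one, map_ofNat] using h'
  have h0 : ‖Polynomial.aeval b₀ F‖ < 1 := by
    rw [← padicInt_toZMod_eq_zero_iff, hF]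
    simpa only [map_add, map_sub, map_mul, map_pow, map_one, map_ofNat, kubertCubic] using h
  obtain ⟨z, hz, hz', -⟩ := hensels_lemma (F := F) (a := b₀) (by rw [h1]; simpa using h0)
  refine ⟨z, ⟨z, rfl, ?_⟩, ?_⟩
  · rw [h1, ← padicInt_toZMod_eq_zero_iff, map_sub, sub_eq_zero] at hz'
    exact hz'
  · rw [hF] at hz
    have := congrArg (PadicInt.Coe.ringHom (p := p)) hz
    simp only [map_add, map_sub, map_mul, map_pow, map_one, map_ofNat, map_zero] at this
    exact this

/-- For odd `p`, a `p`-adic unit is a square if its residue class is. -/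
lemma isSquare (hx : ReducesTo x (b * b)) (h2 : (2 : ZMod p) ≠ 0) (hb : b ≠ 0) : IsSquare x := by
  obtain ⟨r, rfl, hr⟩ := hx
  obtain ⟨b₀, rfl⟩ := ZMod.ringHom_surjective PadicInt.toZMod b
  let F : Polynomial ℤ_[p] := Polynomial.X ^ 2 - Polynomial.C r
  have hF : ∀ z : ℤ_[p], Polynomial.aeval z F = z ^ 2 - r := by
    intro z
    simp [F]
  have h1 : ‖Polynomial.aeval b₀ (Polynomial.derivative F)‖ = 1 := by
    refine le_antisymm (PadicInt.norm_le_one _) (not_lt.1 (mt padicInt_toZMod_eq_zero_iff.2 ?_))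
    have h2' : PadicInt.toZMod (2 : ℤ_[p]) ≠ 0 := by rwa [map_ofNat]
    simp [F, one_add_one_eq_two, h2', hb]
  have h0 : ‖Polynomial.aeval b₀ F‖ < 1 := by
    rw [← padicInt_toZMod_eq_zero_iff, hF, map_sub, map_pow, hr, sq, sub_self]
  obtain ⟨z, hz, -⟩ := hensels_lemma (F := F) (a := b₀) (by rw [h1]; simpa using h0)
  rw [hF, sub_eq_zero] at hz
  exact ⟨z, by rw [← hz, sq]; simp⟩

lemma isSquare_residue (hx : ReducesTo x a) (h : IsSquare x) : IsSquare a := by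
  obtain ⟨y, rfl⟩ := h
  have hy : ‖y‖ ≤ 1 := by
    have := hx.norm_le_one
    rw [norm_mul] at this
    nlinarith [norm_nonneg y]
  obtain ⟨b, hb⟩ := of_norm_le_one hy
  exact ⟨b, hx.unique (hb.mul hb)⟩

end ReducesTo

end Reduction

/-! ### Torsion in the 2-adic setting -/

section TwoAdic

open IsUltrametricDist

lemma padic_norm_add_le {x y : ℚ_[2]} {c : ℝ} (hx : ‖x‖ ≤ c) (hy : ‖y‖ ≤ c) : ‖x + y‖ ≤ c :=
  (norm_add_le_max x y).trans (max_le hx hy)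

lemma padic_norm_sub_le {x y : ℚ_[2]} {c : ℝ} (hx : ‖x‖ ≤ c) (hy : ‖y‖ ≤ c) : ‖x - y‖ ≤ c := by
  rw [sub_eq_add_neg]
  exact padic_norm_add_le hx (by rwa [norm_neg])

lemma padic_norm_add_eq_left {x y : ℚ_[2]} (h : ‖y‖ < ‖x‖) : ‖x + y‖ = ‖x‖ := by
  rw [norm_add_eq_max_of_norm_ne_norm h.ne', max_eq_left h.le]

lemma padic_norm_two : ‖(2 : ℚ_[2])‖ = 1 / 2 := by
  simpa using Padic.norm_p (p := 2)

lemma padic_norm_four : ‖(4 : ℚ_[2])‖ = 1 / 4 := by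
  rw [show (4 : ℚ_[2]) = 2 * 2 by norm_num, norm_mul, padic_norm_two]; norm_num

lemma padic_norm_eight : ‖(8 : ℚ_[2])‖ = 1 / 8 := by
  rw [show (8 : ℚ_[2]) = 4 * 2 by norm_num, norm_mul, padic_norm_two, padic_norm_four]; norm_num

lemma padic_norm_sixteen : ‖(16 : ℚ_[2])‖ = 1 / 16 := by
  rw [show (16 : ℚ_[2]) = 4 * 4 by norm_num, norm_mul, padic_norm_four]; norm_num

/-- The norm on `ℚ₂` takes no value strictly between two consecutive powers of `2`. -/
lemma padic_norm_le_or_le (x : ℚ_[2]) (n : ℤ) :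
    ‖x‖ ≤ (2 : ℝ) ^ n ∨ (2 : ℝ) ^ (n + 1) ≤ ‖x‖ := by
  have := Padic.norm_le_pow_iff_norm_lt_pow_add_one x n
  push_cast at this
  rw [this]
  exact lt_or_ge _ _

/-- Two 2-adic units are congruent modulo `2`. -/
lemma padic_norm_sub_le_of_unit {x y : ℚ_[2]} (hx : ‖x‖ = 1) (hy : ‖y‖ = 1) :
    ‖x - y‖ ≤ 1 / 2 := by
  obtain ⟨a, ha⟩ := ReducesTo.of_norm_le_one hx.le
  obtain ⟨b, hb⟩ := ReducesTo.of_norm_le_one hy.le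
  have ha0 : a ≠ 0 := fun h => by simpa [hx] using ha.norm_lt_one_iff.2 h
  have hb0 : b ≠ 0 := fun h => by simpa [hy] using hb.norm_lt_one_iff.2 h
  have hab : ∀ a b : ZMod 2, a ≠ 0 → b ≠ 0 → a - b = 0 := by decide
  have h := (ha.sub hb).norm_lt_one_iff.2 (hab a b ha0 hb0)
  rcases padic_norm_le_or_le (x - y) (-1) with h' | h'
  · simpa using h'
  · norm_num at h'
    linarith

/-- For a 2-adic unit `r`, the coefficients of Kubert's curve are divisible by `4`, `16`, `16`. -/
lemma padic_norm_kubert_coeff {r : ℚ_[2]} (hr : ‖r‖ = 1) :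
    ‖r ^ 2 - 6 * r + 1‖ ≤ 1 / 4 ∧ ‖8 * r * (r - 1)‖ ≤ 1 / 16 ∧ ‖16 * r ^ 2‖ ≤ 1 / 16 := by
  have h1 : ‖r - 1‖ ≤ 1 / 2 := padic_norm_sub_le_of_unit hr norm_one
  refine ⟨?_, ?_, ?_⟩
  · rw [show r ^ 2 - 6 * r + 1 = (r - 1) * (r - 1) - 4 * r by ring]
    refine padic_norm_sub_le ?_ ?_
    · rw [norm_mul]
      nlinarith [norm_nonneg (r - 1)]
    · rw [norm_mul, padic_norm_four, hr, mul_one]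
  · rw [norm_mul, norm_mul, padic_norm_eight, hr]
    linarith
  · rw [norm_mul, padic_norm_sixteen, norm_pow, hr]
    norm_num

variable {x y a₂ a₄ a₆ : ℚ_[2]}

/-- The lower terms of the cubic, at an argument of norm `X ≥ 1 / 2`. -/
lemma padic_norm_lower_terms (h₂ : ‖a₂‖ ≤ 1 / 4) (h₄ : ‖a₄‖ ≤ 1 / 16) (h₆ : ‖a₆‖ ≤ 1 / 16)
    (hx : 1 / 2 ≤ ‖x‖) : ‖a₂ * x ^ 2 + a₄ * x + a₆‖ ≤ ‖x‖ ^ 2 / 4 := by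
  refine padic_norm_add_le (padic_norm_add_le ?_ ?_) ?_
  · rw [norm_mul, norm_pow]
    nlinarith [sq_nonneg ‖x‖]
  · rw [norm_mul]
    nlinarith [norm_nonneg a₄]
  · nlinarith

lemma padic_norm_y_sq (h₂ : ‖a₂‖ ≤ 1 / 4) (h₄ : ‖a₄‖ ≤ 1 / 16) (h₆ : ‖a₆‖ ≤ 1 / 16)
    (h : y ^ 2 = x ^ 3 + a₂ * x ^ 2 + a₄ * x + a₆) (hx : 1 / 2 ≤ ‖x‖) :
    ‖y‖ ^ 2 = ‖x‖ ^ 3 := by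
  rw [← norm_pow, h, add_assoc, add_assoc, ← add_assoc (a₂ * _), padic_norm_add_eq_left, norm_pow]
  refine (padic_norm_lower_terms h₂ h₄ h₆ hx).trans_lt ?_
  rw [norm_pow]
  nlinarith [sq_pos_of_pos (show 0 < ‖x‖ by linarith)]

/-- A point whose `x`-coordinate is not divisible by `4` is a point with `‖x‖ ≥ 1`: the
intermediate value `‖x‖ = 1 / 2` would give `‖y‖² = 1 / 8`. -/
lemma padic_norm_x_le_or_le (h₂ : ‖a₂‖ ≤ 1 / 4) (h₄ : ‖a₄‖ ≤ 1 / 16) (h₆ : ‖a₆‖ ≤ 1 / 16)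
    (h : y ^ 2 = x ^ 3 + a₂ * x ^ 2 + a₄ * x + a₆) : ‖x‖ ≤ 1 / 4 ∨ 1 ≤ ‖x‖ := by
  by_contra! hcon
  have hx1 : 1 / 2 ≤ ‖x‖ := by
    rcases padic_norm_le_or_le x (-2) with h' | h' <;> norm_num at h' ⊢ <;> linarith
  have hx2 : ‖x‖ ≤ 1 / 2 := by
    rcases padic_norm_le_or_le x (-1) with h' | h' <;> norm_num at h' ⊢ <;> linarith
  have key := padic_norm_y_sq h₂ h₄ h₆ h hx1
  rw [le_antisymm hx2 hx1] at key
  rcases padic_norm_le_or_le y (-2) with h' | h' <;> norm_num at h' <;> nlinarith [norm_nonneg y]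

/-- The duplication formula multiplies a norm `‖x‖ ≥ 1` by exactly `4`. -/
lemma padic_norm_double (h₂ : ‖a₂‖ ≤ 1 / 4) (h₄ : ‖a₄‖ ≤ 1 / 16) (h₆ : ‖a₆‖ ≤ 1 / 16)
    (h : y ^ 2 = x ^ 3 + a₂ * x ^ 2 + a₄ * x + a₆) (hx : 1 ≤ ‖x‖) {ℓ x' : ℚ_[2]}
    (hℓ : 2 * y * ℓ = 3 * x ^ 2 + 2 * a₂ * x + a₄) (hx' : x' = ℓ ^ 2 - a₂ - 2 * x) :
    ‖x'‖ = 4 * ‖x‖ := by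
  have e : 4 * y ^ 2 * x' = x ^ 4 +
      (a₄ ^ 2 - 4 * a₂ * a₆ - (2 * a₄ * x ^ 2 + 8 * a₆ * x)) := by
    have hsq := congrArg (· ^ 2) hℓ
    rw [hx']
    linear_combination hsq - (4 * a₂ + 8 * x) * h
  have hlow : ‖a₄ ^ 2 - 4 * a₂ * a₆ - (2 * a₄ * x ^ 2 + 8 * a₆ * x)‖ < ‖x ^ 4‖ := by
    have hx2 : 1 ≤ ‖x‖ ^ 2 := one_le_pow₀ hx
    have hb : ‖a₄ ^ 2 - 4 * a₂ * a₆ - (2 * a₄ * x ^ 2 + 8 * a₆ * x)‖ ≤ ‖x‖ ^ 2 / 2 := by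
      refine padic_norm_sub_le (padic_norm_sub_le ?_ ?_) (padic_norm_add_le ?_ ?_)
      · rw [norm_pow]
        nlinarith [norm_nonneg a₄]
      · rw [norm_mul, norm_mul, padic_norm_four]
        nlinarith [norm_nonneg a₂, norm_nonneg a₆, mul_le_mul h₂ h₆ (norm_nonneg _) (by norm_num)]
      · rw [norm_mul, norm_mul, norm_pow, padic_norm_two]
        nlinarith [norm_nonneg a₄]
      · rw [norm_mul, norm_mul, padic_norm_eight]
        have : ‖a₆‖ * ‖x‖ ≤ 1 / 16 * ‖x‖ := by gcongr
        nlinarith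
    rw [norm_pow]
    nlinarith
  have key := congrArg norm e
  rw [padic_norm_add_eq_left hlow, norm_mul, norm_mul, norm_pow, norm_pow, padic_norm_four,
    padic_norm_y_sq h₂ h₄ h₆ h (by linarith)] at key
  have h3 : ‖x‖ ^ 3 ≠ 0 := pow_ne_zero _ (by linarith)
  apply mul_left_cancel₀ h3
  linear_combination 4 * key

end TwoAdic

section TwoAdicTorsion

open WeierstrassCurve.Affine

variable {K : Type*} [Field K] {r : K} (ι : K →+* ℚ_[2])

lemma map_kubertCurve_equation {x y : K} (h : (kubertCurve r).Nonsingular x y) :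
    ι y ^ 2 = ι x ^ 3 + (ι r ^ 2 - 6 * ι r + 1) * ι x ^ 2 + 8 * ι r * (ι r - 1) * ι x +
      16 * ι r ^ 2 := by
  have := congrArg ι (kubertCurve_equation_iff.1 h.left)
  simpa only [map_add, map_sub, map_mul, map_pow, map_one, map_ofNat, kubertCubic] using this

variable {ι} [DecidableEq K] [CharZero K]

/-- A torsion point has an `x`-coordinate divisible by `4`: otherwise repeated doubling produces
points with `x`-coordinates of strictly increasing norm. -/
lemma padic_norm_x_le_of_torsion (hr : ‖ι r‖ = 1) {x y : K} (h : (kubertCurve r).Nonsingular x y)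
    (ht : IsOfFinAddOrder (Point.some x y h)) : ‖ι x‖ ≤ 1 / 4 := by
  obtain ⟨h₂, h₄, h₆⟩ := padic_norm_kubert_coeff hr
  refine (padic_norm_x_le_or_le h₂ h₄ h₆ (map_kubertCurve_equation ι h)).resolve_right ?_
  intro hx
  have key : ∀ k : ℕ, ∃ (x' y' : K) (h' : (kubertCurve r).Nonsingular x' y'),
      2 ^ k • Point.some x y h = Point.some x' y' h' ∧ ‖ι x'‖ = 4 ^ k * ‖ι x‖ := by
    intro k
    induction k with
    | zero => exact ⟨x, y, h, by simp, by simp⟩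
    | succ k ih =>
      obtain ⟨x', y', h', e, hn⟩ := ih
      have hx' : 1 ≤ ‖ι x'‖ := by
        rw [hn]
        exact one_le_mul_of_one_le_of_one_le (one_le_pow₀ (by norm_num)) hx
      have hy' : y' ≠ 0 := by
        rintro rfl
        have := padic_norm_y_sq h₂ h₄ h₆ (map_kubertCurve_equation ι h') (by linarith)
        rw [map_zero, norm_zero] at this
        have h3 : 0 < ‖ι x'‖ ^ 3 := by positivity
        linarith
      obtain ⟨ℓ, hℓ⟩ : ∃ ℓ, 2 * y' * ℓ =
          3 * x' ^ 2 + 2 * (r ^ 2 - 6 * r + 1) * x' + 8 * r * (r - 1) :=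
        ⟨_, mul_div_cancel₀ _ (mul_ne_zero two_ne_zero hy')⟩
      obtain ⟨h'', e''⟩ := exists_two_nsmul h' hy' hℓ rfl rfl
      refine ⟨_, _, h'', ?_, ?_⟩
      · rw [pow_succ, mul_nsmul, e, e'']
      · have hℓ' := congrArg ι hℓ
        simp only [map_add, map_sub, map_mul, map_pow, map_one, map_ofNat] at hℓ'
        rw [padic_norm_double h₂ h₄ h₆ (map_kubertCurve_equation ι h') hx' hℓ'
          (by simp only [map_sub, map_add, map_mul, map_pow, map_one, map_ofNat]), hn]
        ring
  have hfin := ht.finite_multiples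
  have hinj : Function.Injective (fun k : ℕ => 2 ^ k • Point.some x y h) := by
    intro i j hij
    obtain ⟨x₁, y₁, h₁, e₁, n₁⟩ := key i
    obtain ⟨x₂, y₂, h₂, e₂, n₂⟩ := key j
    simp only [e₁, e₂, Point.some.injEq] at hij
    rw [hij.1, n₂] at n₁
    have h4 := mul_right_cancel₀ (by linarith) n₁
    exact (pow_right_injective₀ (by norm_num) (by norm_num) h4).symm
  exact Set.infinite_range_of_injective hinj
    (hfin.subset (Set.range_subset_iff.2 fun k => ⟨2 ^ k, rfl⟩))

/-- Two torsion points with `x`-coordinates congruent modulo `8`, one of them `(x₀, y₀)` with `y₀`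
exactly divisible by `4`, agree up to sign: otherwise the slope of one of the lines through `(x, y)`
and `(x₀, ± y₀)` has norm at least `1`, and the sum is a torsion point with `x`-coordinate not
divisible by `4`. -/
lemma eq_or_eq_neg_of_torsion (hr : ‖ι r‖ = 1) {x y x₀ y₀ : K}
    (h : (kubertCurve r).Nonsingular x y) (h₀ : (kubertCurve r).Nonsingular x₀ y₀)
    (ht : IsOfFinAddOrder (Point.some x y h)) (ht₀ : IsOfFinAddOrder (Point.some x₀ y₀ h₀))
    (hy₀ : ‖ι y₀‖ = 1 / 4) (hx : ‖ι x - ι x₀‖ ≤ 1 / 8) :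
    Point.some x y h = Point.some x₀ y₀ h₀ ∨ Point.some x y h = -Point.some x₀ y₀ h₀ := by
  obtain ⟨h₂, h₄, h₆⟩ := padic_norm_kubert_coeff hr
  have hx₁ := padic_norm_x_le_of_torsion hr h ht
  have hx₀ := padic_norm_x_le_of_torsion hr h₀ ht₀
  rw [← Point.X_eq_iff]
  by_contra hne
  have hd : ι x - ι x₀ ≠ 0 := by
    rw [← map_sub]
    exact (map_ne_zero ι).2 (sub_ne_zero.2 hne)
  have hd0 : 0 < ‖ι x - ι x₀‖ := norm_pos_iff.2 hd
  -- The slope towards a torsion point `(x₀, w)` has norm less than `1`.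
  have key : ∀ (w : K) (hw : (kubertCurve r).Nonsingular x₀ w),
      IsOfFinAddOrder (Point.some x₀ w hw) → ‖ι y - ι w‖ < 1 / 8 := by
    intro w hw htw
    obtain ⟨y₃, h₃, e⟩ := exists_add_of_X_ne h hw hne
    have ht₃ : IsOfFinAddOrder (Point.some _ y₃ h₃) := e ▸ ht.add htw
    have hn := padic_norm_x_le_of_torsion hr h₃ ht₃
    simp only [map_add, map_sub, map_mul, map_pow, map_one, map_ofNat, map_div₀] at hn
    have hq : ‖((ι y - ι w) / (ι x - ι x₀)) ^ 2‖ ≤ 1 / 4 := by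
      have := padic_norm_add_le hn (padic_norm_add_le (padic_norm_add_le h₂ hx₁) hx₀)
      ring_nf at this ⊢
      exact this
    rw [norm_pow, norm_div, div_pow, div_le_iff₀ (by positivity)] at hq
    nlinarith [norm_nonneg (ι y - ι w)]
  have h1 := key y₀ h₀ ht₀
  have hneg : -Point.some x₀ y₀ h₀ = Point.some x₀ (-y₀) (by
      rw [← kubertCurve_negY (r := r) x₀ y₀]; exact (nonsingular_neg ..).2 h₀) := by
    rw [Point.neg_some]
    simp only [kubertCurve_negY]
  have h2 := key (-y₀) _ (hneg ▸ ht₀.neg)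
  have h3 : ‖2 * ι y₀‖ = 1 / 8 := by
    rw [norm_mul, padic_norm_two, hy₀]; norm_num
  have h4 : 2 * ι y₀ = (ι y - ι (-y₀)) - (ι y - ι y₀) := by
    rw [map_neg]; ring
  have h5 : ‖(ι y - ι (-y₀)) - (ι y - ι y₀)‖ < 1 / 8 :=
    lt_of_le_of_lt (padic_norm_sub_le (le_max_left _ _) (le_max_right _ _)) (max_lt h2 h1)
  rw [← h4, h3] at h5
  exact lt_irrefl _ h5

variable [(kubertCurve r).IsElliptic]

/-- If `r` is a 2-adic unit, the five points of `ℤ/5ℤ` represent all residue classes of torsion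
points, so that there is no further torsion. -/
lemma mem_range_kubertHom_of_torsion (hr : ‖ι r‖ = 1) (P : (kubertCurve r).Point)
    (ht : IsOfFinAddOrder P) : P ∈ (kubertHom r).range := by
  have hT : kubertPoint r ∈ (kubertHom r).range :=
    ⟨1, by simpa using kubertHom_intCast (r := r) 1⟩
  have htT : IsOfFinAddOrder (kubertPoint r) :=
    isOfFinAddOrder_iff_nsmul_eq_zero.2 ⟨5, by norm_num, five_nsmul_kubertPoint⟩
  obtain ⟨h', e⟩ := two_nsmul_kubertPoint (r := r)
  have hT2 := AddSubgroup.nsmul_mem _ hT 2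
  have htT2 := htT.nsmul (n := 2)
  rw [e] at hT2 htT2
  cases P with
  | zero => exact zero_mem _
  | some x y h =>
    have hx := padic_norm_x_le_of_torsion hr h ht
    have hx4 : ‖ι x / 4‖ ≤ 1 := by
      rw [norm_div, padic_norm_four]; linarith
    have hcase : ‖ι x - ι 0‖ ≤ 1 / 8 ∨ ‖ι x - ι (4 * r)‖ ≤ 1 / 8 := by
      rcases padic_norm_le_or_le (ι x / 4) (-1) with h' | h'
      · left
        rw [norm_div, padic_norm_four] at h'
        rw [map_zero, sub_zero]
        norm_num at h'
        linarith
      · right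
        have hu : ‖ι x / 4‖ = 1 := le_antisymm hx4 (by simpa using h')
        rw [show ι x - ι (4 * r) = 4 * (ι x / 4 - ι r) by
          rw [map_mul, map_ofNat]; ring, norm_mul, padic_norm_four]
        linarith [padic_norm_sub_le_of_unit hu hr]
    rcases hcase with hc | hc
    · rcases eq_or_eq_neg_of_torsion hr h _ ht htT
        (by rw [map_mul, map_ofNat, norm_mul, padic_norm_four, hr, mul_one]) hc with e | e
      · rw [e]; exact hT
      · rw [e]; exact neg_mem hT
    · rcases eq_or_eq_neg_of_torsion hr h _ ht htT2
        (by rw [map_mul, map_neg, map_ofNat, map_pow, norm_mul, norm_neg, norm_pow,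
              padic_norm_four, hr]; norm_num) hc with e | e
      · rw [e]; exact hT2
      · rw [e]; exact neg_mem hT2

lemma torsionIsZMod5_of_padic_unit (hr : ‖ι r‖ = 1) : TorsionIsZMod5 (kubertCurve r) :=
  torsionIsZMod5_of_forall_mem_range (mem_range_kubertHom_of_torsion hr)

end TwoAdicTorsion

/-! ### Independence by 2-descent -/

section Descent

open WeierstrassCurve.Affine

lemma eq_zero_of_two_nsmul_eq_zero {K : Type*} [Field K] [DecidableEq K] {r : K}
    (ht : TorsionIsZMod5 (kubertCurve r)) {P : (kubertCurve r).Point} (h : (2 : ℕ) • P = 0) :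
    P = 0 := by
  obtain ⟨e⟩ := ht
  have hP : P ∈ AddCommGroup.torsion (kubertCurve r).Point :=
    isOfFinAddOrder_iff_nsmul_eq_zero.2 ⟨2, by norm_num, h⟩
  have h0 : (2 : ℕ) • e ⟨P, hP⟩ = 0 := by
    rw [← map_nsmul, map_eq_zero_iff e e.injective]
    exact Subtype.ext h
  have h1 : ∀ a : ZMod 5, (2 : ℕ) • a = 0 → a = 0 := by decide
  have h2 := (map_eq_zero_iff e e.injective).1 (h1 _ h0)
  exact congrArg Subtype.val h2

lemma kubertCubic_ne_zero {K : Type*} [Field K] [DecidableEq K] {r : K}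
    [(kubertCurve r).IsElliptic]
    (ht : TorsionIsZMod5 (kubertCurve r)) (x : K) : kubertCubic r x ≠ 0 := by
  intro h
  have hx : (kubertCurve r).Nonsingular x 0 :=
    equation_iff_nonsingular.1 (kubertCurve_equation_iff.2 (by rw [h]; ring))
  refine Point.some_ne_zero hx (eq_zero_of_two_nsmul_eq_zero ht ?_)
  rw [two_nsmul, Point.add_self_of_Y_eq]
  rw [kubertCurve_negY, neg_zero]

/-- In an abelian group without 2-torsion, elements separated in a triangular way by subgroups that
contain all doubles are linearly independent: the coefficients of a relation would all be even, and
infinite descent applies. -/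
lemma linearIndependent_of_subgroups {G : Type*} [AddCommGroup G]
    (h2 : ∀ g : G, (2 : ℕ) • g = 0 → g = 0) (P : Fin 3 → G) (H₀ H₁ H₂ : AddSubgroup G)
    (d₀ : ∀ g : G, (2 : ℕ) • g ∈ H₀) (d₁ : ∀ g : G, (2 : ℕ) • g ∈ H₁)
    (d₂ : ∀ g : G, (2 : ℕ) • g ∈ H₂) (h00 : P 0 ∉ H₀) (h10 : P 0 ∈ H₁) (h11 : P 1 ∉ H₁)
    (h20 : P 0 ∈ H₂) (h21 : P 1 ∈ H₂) (h22 : P 2 ∉ H₂) : LinearIndependent ℤ P := by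
  have even_mem : ∀ (H : AddSubgroup G), (∀ g : G, (2 : ℕ) • g ∈ H) → ∀ (n : ℤ) (g : G),
      Even n → n • g ∈ H := by
    rintro H d n g ⟨m, rfl⟩
    have := d (m • g)
    rwa [two_nsmul, ← add_smul] at this
  have even_of : ∀ (H : AddSubgroup G), (∀ g : G, (2 : ℕ) • g ∈ H) → ∀ (n : ℤ) (g : G),
      g ∉ H → n • g ∈ H → Even n := by
    intro H d n g hg hn
    by_contra hodd
    obtain ⟨m, rfl⟩ := Int.not_even_iff_odd.1 hodd
    apply hg
    have := sub_mem hn (even_mem H d (2 * m) g (even_two_mul m))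
    rwa [add_smul, one_smul, add_sub_cancel_left] at this
  -- All coefficients of a relation are divisible by every power of `2`.
  have key : ∀ (k : ℕ) (a b c : ℤ), a • P 0 + b • P 1 + c • P 2 = 0 →
      (2 : ℤ) ^ k ∣ a ∧ (2 : ℤ) ^ k ∣ b ∧ (2 : ℤ) ^ k ∣ c := by
    intro k
    induction k with
    | zero => intro a b c _; simp
    | succ k ih =>
      intro a b c h
      have hc : Even c := by
        refine even_of H₂ d₂ c _ h22 ?_
        have : c • P 2 = -(a • P 0 + b • P 1) := by
          rw [eq_neg_iff_add_eq_zero, add_comm, h]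
        rw [this]
        exact neg_mem (add_mem (zsmul_mem h20 a) (zsmul_mem h21 b))
      have hb : Even b := by
        refine even_of H₁ d₁ b _ h11 ?_
        have : b • P 1 = -(a • P 0 + c • P 2) := by
          rw [eq_neg_iff_add_eq_zero, ← h]; abel
        rw [this]
        exact neg_mem (add_mem (zsmul_mem h10 a) (even_mem H₁ d₁ c _ hc))
      have ha : Even a := by
        refine even_of H₀ d₀ a _ h00 ?_
        have : a • P 0 = -(b • P 1 + c • P 2) := by
          rw [eq_neg_iff_add_eq_zero, ← h]; abel
        rw [this]
        exact neg_mem (add_mem (even_mem H₀ d₀ b _ hb) (even_mem H₀ d₀ c _ hc))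
      obtain ⟨a, rfl⟩ := ha
      obtain ⟨b, rfl⟩ := hb
      obtain ⟨c, rfl⟩ := hc
      obtain ⟨ia, ib, ic⟩ := ih a b c (h2 _ (by
        rw [← h, two_nsmul]; simp only [add_smul]; abel))
      simp only [← two_mul, pow_succ']
      exact ⟨mul_dvd_mul_left 2 ia, mul_dvd_mul_left 2 ib, mul_dvd_mul_left 2 ic⟩
  have zero_of : ∀ n : ℤ, (∀ k : ℕ, (2 : ℤ) ^ k ∣ n) → n = 0 := by
    intro n hn
    refine Int.eq_zero_of_abs_lt_dvd (hn n.natAbs) ?_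
    rw [Int.abs_eq_natAbs]
    exact_mod_cast Nat.lt_two_pow_self
  rw [Fintype.linearIndependent_iff]
  intro g hg
  rw [Fin.sum_univ_three] at hg
  intro i
  refine zero_of _ fun k => ?_
  obtain ⟨h0, h1, h2⟩ := key k _ _ _ hg
  fin_cases i
  exacts [h0, h1, h2]

variable {K : Type*} [Field K] [DecidableEq K] {r : K} {L : Type*} [Field L]

/-- For a root `θ` of the cubic in an extension `L` of `K` that is not the `x`-coordinate of a point
over `K`, the subgroup of points at which `x - θ` is a square in `L`. -/
def descentSubgroup (r : K) (ι : K →+* L) (θ : L) (hθ : kubertCubic (ι r) θ = 0)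
    (hno : ∀ x : K, ι x - θ ≠ 0) : AddSubgroup (kubertCurve r).Point where
  carrier := {P | ∀ (x y : K) (h : (kubertCurve r).Nonsingular x y), P = Point.some x y h →
    IsSquare (ι x - θ)}
  zero_mem' := fun _ _ h e => absurd e.symm (Point.some_ne_zero h)
  neg_mem' := by
    rintro P hP x y h e
    have e' : P = -Point.some x y h := by rw [← e, neg_neg]
    rw [Point.neg_some] at e'
    exact hP _ _ _ e'
  add_mem' := by
    rintro P Q hP hQ x y h e
    cases P with
    | zero => exact hQ x y h (by rw [← e]; exact (zero_add Q).symm)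
    | some x₁ y₁ h₁ =>
      cases Q with
      | zero => exact hP x y h (by rw [← e]; exact (add_zero _).symm)
      | some x₂ y₂ h₂ =>
        have s₁ := hP _ _ _ rfl
        have s₂ := hQ _ _ _ rfl
        have s := (isSquare_prod_sub_root ι hθ h₁ h₂ h e).div (s₁.mul s₂)
        rwa [mul_div_cancel_left₀ _ (mul_ne_zero (hno _) (hno _))] at s

lemma two_nsmul_mem_descentSubgroup {ι : K →+* L} {θ : L} (hθ : kubertCubic (ι r) θ = 0)
    (hno : ∀ x : K, ι x - θ ≠ 0) (P : (kubertCurve r).Point) :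
    (2 : ℕ) • P ∈ descentSubgroup r ι θ hθ hno := by
  rintro x y h e
  rw [two_nsmul] at e
  cases P with
  | zero => exact absurd ((zero_add _).symm.trans e).symm (Point.some_ne_zero h)
  | some x₁ y₁ h₁ =>
    have s := (isSquare_prod_sub_root ι hθ h₁ h₁ h e).div (IsSquare.mul_self (ι x₁ - θ))
    rwa [mul_div_cancel_left₀ _ (mul_ne_zero (hno _) (hno _))] at s

lemma mem_descentSubgroup_iff {ι : K →+* L} {θ : L} {hθ : kubertCubic (ι r) θ = 0}
    {hno : ∀ x : K, ι x - θ ≠ 0} {P : (kubertCurve r).Point} {x : K} (hP : HasXCoord P x) :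
    P ∈ descentSubgroup r ι θ hθ hno ↔ IsSquare (ι x - θ) := by
  obtain ⟨y, h, rfl⟩ := hP
  refine ⟨fun H => H x y h rfl, ?_⟩
  rintro H x' y' h' e
  obtain ⟨rfl, -⟩ := (Point.some.injEq ..).mp e
  exact H

end Descent

/-! ### Characters from p-adic embeddings -/

section LocalCriterion

variable {K : Type*} [Field K] [DecidableEq K] {r : K}

/-- A subgroup of `E_r(K)` cut out by a quadratic character: it comes from an embedding of `K` into
`ℚ_p` for an odd prime `p` and a simple root `b` modulo `p` of the cubic. Membership of a point is
decided by the residue class of its `x`-coordinate. -/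
lemma exists_descent_subgroup [(kubertCurve r).IsElliptic] (ht : TorsionIsZMod5 (kubertCurve r)) {p : ℕ} [Fact p.Prime]
    (h2 : (2 : ZMod p) ≠ 0) (ι : K →+* ℚ_[p]) {a b : ZMod p} (hr : ReducesTo (ι r) a)
    (hb : kubertCubic a b = 0)
    (hb' : 3 * b ^ 2 + 2 * (a ^ 2 - 6 * a + 1) * b + 8 * a * (a - 1) ≠ 0) :
    ∃ H : AddSubgroup (kubertCurve r).Point, (∀ P, (2 : ℕ) • P ∈ H) ∧
      (∀ P x c d, HasXCoord P x → ReducesTo (ι x) c → c - b = d * d → d ≠ 0 → P ∈ H) ∧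
      (∀ P x c, HasXCoord P x → ReducesTo (ι x) c → ¬ IsSquare (c - b) → P ∉ H) := by
  obtain ⟨θ, hθb, hθ⟩ := hr.exists_kubertCubic_root hb hb'
  have hno : ∀ x : K, ι x - θ ≠ 0 := by
    intro x hx
    apply kubertCubic_ne_zero ht x
    rw [← sub_eq_zero.1 hx] at hθ
    apply ι.injective
    rw [map_zero, ← hθ]
    simp only [map_add, map_sub, map_mul, map_pow, map_one, map_ofNat, kubertCubic]
  refine ⟨descentSubgroup r ι θ hθ hno, two_nsmul_mem_descentSubgroup hθ hno, ?_, ?_⟩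
  · intro P x c d hP hx hd hd0
    rw [mem_descentSubgroup_iff hP]
    exact (hd ▸ hx.sub hθb).isSquare h2 hd0
  · intro P x c hP hx hc hmem
    rw [mem_descentSubgroup_iff hP] at hmem
    exact hc ((hx.sub hθb).isSquare_residue hmem)

lemma three_le_rank_of_hasIndependentPoints {x : Fin 3 → K}
    (h : HasIndependentPoints (kubertCurve r) x) :
    3 ≤ Module.rank ℤ (kubertCurve r).Point := by
  obtain ⟨P, -, hP⟩ := h
  simpa using hP.cardinal_lift_le_rank

end LocalCriterion

/-! ### Embeddings of `ℚ(t)` into p-adic fields -/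

section Embedding

/-- Every residue class of `p`-adic integers contains numbers that are transcendental over `ℚ`,
and such a number gives an embedding of `ℚ(t)`. -/
lemma exists_ratFunc_embedding (p : ℕ) [Fact p.Prime] (c n : ℕ) :
    ∃ (ι : RatFunc ℚ →+* ℚ_[p]) (z : ℤ_[p]), ι RatFunc.X = c + p ^ n * z := by
  have hp : (p : ℚ_[p]) ≠ 0 := by exact_mod_cast (Fact.out : p.Prime).ne_zero
  obtain ⟨σ, hσ⟩ : ∃ σ : ℚ_[p], Transcendental ℚ σ := by
    by_contra! hcon
    have huniv : {x : ℚ_[p] | IsAlgebraic ℚ x} = Set.univ :=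
      Set.eq_univ_of_forall fun x => not_not.1 (hcon x)
    have hcount := Algebraic.countable ℚ ℚ_[p]
    rw [huniv, Set.countable_univ_iff, ← Cardinal.mk_le_aleph0_iff] at hcount
    have := continuum_le_cardinal_of_nontriviallyNormedField ℚ_[p]
    exact absurd (this.trans hcount) (not_le.2 Cardinal.aleph0_lt_continuum)
  -- Scaling by a power of `p` makes the transcendental number integral.
  obtain ⟨k, hk⟩ : ∃ k : ℕ, ‖(p : ℚ_[p]) ^ k * σ‖ ≤ 1 := by
    obtain ⟨k, hk⟩ := PadicInt.exists_pow_neg_lt p (ε := (‖σ‖ + 1)⁻¹) (by positivity)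
    refine ⟨k, ?_⟩
    have h1 : (0 : ℝ) < ‖σ‖ + 1 := by positivity
    rw [norm_mul, Padic.norm_p_pow]
    calc (p : ℝ) ^ (-(k : ℤ)) * ‖σ‖ ≤ (‖σ‖ + 1)⁻¹ * (‖σ‖ + 1) := by gcongr; linarith
      _ = 1 := inv_mul_cancel₀ h1.ne'
  set τ : ℚ_[p] := c + p ^ n * (p ^ k * σ) with hτ
  have hτt : Transcendental ℚ τ := by
    intro halg
    apply hσ
    have e : σ = (τ - c) / p ^ (n + k) := by
      rw [hτ, eq_div_iff (pow_ne_zero _ hp), pow_add]; ring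
    have hnat : ∀ m : ℕ, IsAlgebraic ℚ (m : ℚ_[p]) := fun m => by
      simpa using isAlgebraic_algebraMap (R := ℚ) (A := ℚ_[p]) (m : ℚ)
    rw [e, div_eq_mul_inv]
    exact (halg.sub (hnat c)).mul ((hnat p).pow _).inv
  have hinj := transcendental_iff_injective.1 hτt
  refine ⟨RatFunc.liftRingHom (Polynomial.aeval τ : Polynomial ℚ →ₐ[ℚ] ℚ_[p]).toRingHom
    (nonZeroDivisors_le_comap_nonZeroDivisors_of_injective _ hinj), ⟨_, hk⟩, ?_⟩
  rw [← RatFunc.algebraMap_X, RatFunc.liftRingHom_algebraMap]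
  simp [hτ]

lemma reducesTo_of_eq {p : ℕ} [Fact p.Prime] {x : ℚ_[p]} {c : ℕ} {z : ℤ_[p]}
    (h : x = c + p ^ 1 * z) : ReducesTo x c :=
  ⟨c + p * z, by simp [h], by simp⟩

lemma ratFunc_algebraMap_ne_zero {f : Polynomial ℚ} {c : ℚ} (h : f.eval c ≠ 0) :
    algebraMap (Polynomial ℚ) (RatFunc ℚ) f ≠ 0 := by
  refine RatFunc.algebraMap_ne_zero ?_
  rintro rfl
  simp at h

end Embedding

/-! ### Infinitely many `j`-invariants -/

section JInvariant

lemma finite_setOf_quadratic_eq_zero {a b c : ℚ} (h : a ≠ 0 ∨ b ≠ 0 ∨ c ≠ 0) :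
    {x : ℚ | a * x ^ 2 + b * x + c = 0}.Finite := by
  let f : Polynomial ℚ := Polynomial.C a * Polynomial.X ^ 2 + Polynomial.C b * Polynomial.X +
    Polynomial.C c
  have hf : f ≠ 0 := by
    intro h0
    have h2 := congrArg (Polynomial.coeff · 2) h0
    have h1 := congrArg (Polynomial.coeff · 1) h0
    have h0 := congrArg (Polynomial.coeff · 0) h0
    simp [f, Polynomial.coeff_X, Polynomial.coeff_C] at h0 h1 h2
    tauto
  refine (Polynomial.finite_setOfPred_isRoot hf).subset fun x hx => ?_
  simpa [f, Polynomial.IsRoot] using hx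

/-- A non-constant quotient of quadratic polynomials has finite fibres. -/
lemma finite_fibre_of_quadratic {p q : ℚ → ℚ} {v a b c : ℚ} (h : a ≠ 0 ∨ b ≠ 0 ∨ c ≠ 0)
    (hpq : ∀ w, p w - v * q w = a * w ^ 2 + b * w + c) : {w | q w ≠ 0 ∧ p w / q w = v}.Finite := by
  refine (finite_setOf_quadratic_eq_zero h).subset ?_
  rintro w ⟨hq, hw⟩
  rw [Set.mem_ofPred_eq, ← hpq, sub_eq_zero]
  exact (div_eq_iff hq).1 hw

/-- A value of the `j`-invariant is attained for finitely many parameters `r`. -/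
lemma finite_setOf_j_eq (j : ℚ) :
    {r : ℚ | ∃ hE : (kubertCurve r).IsElliptic,
      j = @WeierstrassCurve.j ℚ _ (kubertCurve r) hE}.Finite := by
  let f : Polynomial ℚ := (16 * (Polynomial.X ^ 4 - 12 * Polynomial.X ^ 3 +
    14 * Polynomial.X ^ 2 + 12 * Polynomial.X + 1)) ^ 3 -
    Polynomial.C j * (2 ^ 12 * Polynomial.X ^ 5 * (Polynomial.X ^ 2 - 11 * Polynomial.X - 1))
  have hf : f ≠ 0 := by
    intro h0
    have := congrArg (Polynomial.eval 0) h0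
    simp [f] at this
  refine (Polynomial.finite_setOfPred_isRoot hf).subset ?_
  rintro r ⟨hE, hj⟩
  have key : j * WeierstrassCurve.Δ (kubertCurve r) = WeierstrassCurve.c₄ (kubertCurve r) ^ 3 := by
    rw [hj, WeierstrassCurve.j, ← WeierstrassCurve.coe_Δ', mul_right_comm, Units.inv_mul, one_mul]
  rw [kubertCurve_Δ, kubertCurve_c₄] at key
  simp only [Set.mem_ofPred_eq, Polynomial.IsRoot, f, Polynomial.eval_sub, Polynomial.eval_mul,
    Polynomial.eval_pow, Polynomial.eval_add, Polynomial.eval_X, Polynomial.eval_C,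
    Polynomial.eval_one, Polynomial.eval_ofNat]
  linear_combination -key

lemma infinitelyManyRankThreeMembers_of_injective {adm : ℚ → Prop} {r : ℚ → ℚ}
    {x : ℚ → Fin 3 → ℚ} {t : ℕ → ℚ} (ht : Function.Injective t)
    (hfib : ∀ r₀, {t | adm t ∧ r t = r₀}.Finite)
    (hgood : ∀ n, adm (t n) ∧ (kubertCurve (r (t n))).IsElliptic ∧
      TorsionIsZMod5 (kubertCurve (r (t n))) ∧
      HasIndependentPoints (kubertCurve (r (t n))) (x (t n))) :
    InfinitelyManyRankThreeMembers adm r x := by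
  intro hfin
  refine Set.infinite_range_of_injective ht ((hfin.biUnion fun j _ =>
    (finite_setOf_j_eq j).biUnion fun r₀ _ => hfib r₀).subset ?_)
  rintro _ ⟨n, rfl⟩
  obtain ⟨hadm, hE, htor, hind⟩ := hgood n
  simp only [Set.mem_iUnion]
  exact ⟨_, ⟨t n, hadm, hE, rfl, htor, hind, three_le_rank_of_hasIndependentPoints hind⟩,
    r (t n), ⟨hE, rfl⟩, hadm, rfl⟩

end JInvariant

/-! ### Elliptic members and 2-adic units -/

section Auxiliary

lemma not_isSquare_of_lt_of_lt {n m : ℕ} (h : m * m < n) (h' : n < (m + 1) * (m + 1)) :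
    ¬ IsSquare (n : ℚ) := by
  rw [Rat.isSquare_natCast_iff]
  rintro ⟨k, rfl⟩
  have h1 := lt_of_mul_self_lt_mul_self₀ (Nat.zero_le _) h
  have h2 := lt_of_mul_self_lt_mul_self₀ (Nat.zero_le _) h'
  omega

/-- Over `ℚ` the discriminant vanishes only at `r = 0`, because its factor `r² - 11r - 1` has the
irrational roots `(11 ± 5√5) / 2`. -/
lemma kubertCurve_isElliptic_rat {r : ℚ} (hr : r ≠ 0) : (kubertCurve r).IsElliptic := by
  refine kubertCurve_isElliptic hr fun h => ?_
  have h5 : ¬ IsSquare ((5 : ℕ) : ℚ) := not_isSquare_of_lt_of_lt (m := 2) (by simp) (by simp)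
  exact h5 ⟨(2 * r - 11) / 5, by push_cast; linear_combination (-4 / 25 : ℚ) * h⟩

lemma everyMemberHasPoints_of_isSquare {adm : ℚ → Prop} {r : ℚ → ℚ} {x : ℚ → Fin 3 → ℚ}
    (hr : ∀ t, adm t → r t ≠ 0) (hx : ∀ t, adm t → ∀ i, IsSquare (kubertCubic (r t) (x t i))) :
    EveryMemberHasPoints adm r x := by
  intro t ht
  have hE := kubertCurve_isElliptic_rat (hr t ht)
  exact ⟨hE, ⟨kubertHom _, kubertHom_injective _⟩, fun i => exists_hasXCoord (hx t ht i)⟩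

lemma kubertCurve_isElliptic_of_padic_unit {K : Type*} [Field K] [CharZero K] {r : K}
    (ι : K →+* ℚ_[2]) (hr : ‖ι r‖ = 1) : (kubertCurve r).IsElliptic := by
  refine kubertCurve_isElliptic ?_ ?_
  · rintro rfl
    simp at hr
  · obtain ⟨a, ha⟩ := ReducesTo.of_norm_le_one hr.le
    have ha0 : a ≠ 0 := fun h => by simpa [hr] using ha.norm_lt_one_iff.2 h
    have h11 := ((ha.pow 2).sub ((ReducesTo.ofNat 11).mul ha)).sub ReducesTo.one
    have hdec : ∀ a : ZMod 2, a ≠ 0 → a ^ 2 - 11 * a - 1 ≠ 0 := by decide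
    have := h11.ne_zero (hdec a ha0)
    intro h
    apply this
    rw [← map_zero ι, ← h]
    simp only [map_sub, map_mul, map_pow, map_one, map_ofNat]

lemma padicInt_coe_ringHom_apply {p : ℕ} [Fact p.Prime] (z : ℤ_[p]) :
    PadicInt.Coe.ringHom z = (z : ℚ_[p]) := rfl

lemma padic_norm_odd {x : ℚ_[2]} (z : ℤ_[2]) (hx : x = 2 * PadicInt.Coe.ringHom z + 1) :
    ‖x‖ = 1 := by
  have h : ReducesTo (2 * z + 1 : ℚ_[2]) (2 * PadicInt.toZMod z + 1) :=
    ((ReducesTo.ofNat 2).mul ⟨z, rfl, rfl⟩).add .one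
  have h2 : ∀ a : ZMod 2, 2 * a + 1 ≠ 0 := by decide
  rw [hx]
  exact h.norm_eq_one (h2 _)

end Auxiliary

/-! ### Clearing denominators and reducing quotients -/

section Denominators

variable {K : Type*} [Field K]

/-- The equation on the model with cleared denominators. -/
lemma kubertCubic_div_eq {R D u V q : K} (hD : D ≠ 0)
    (h : u ^ 3 + (R ^ 2 - 6 * R * D + D ^ 2) * u ^ 2 + 8 * R * (R - D) * D ^ 2 * u +
      16 * R ^ 2 * D ^ 4 = V ^ 2 * q) :
    kubertCubic (R / D) (u / D ^ 2) = (V / D ^ 3) ^ 2 * q := by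
  have e : kubertCubic (R / D) (u / D ^ 2) = (u ^ 3 + (R ^ 2 - 6 * R * D + D ^ 2) * u ^ 2 +
      8 * R * (R - D) * D ^ 2 * u + 16 * R ^ 2 * D ^ 4) / D ^ 6 := by
    rw [kubertCubic]
    field_simp
  rw [e, h]
  field_simp

lemma ReducesTo.div_of_eq_mul {p : ℕ} [Fact p.Prime] {x y : ℚ_[p]} {a b c : ZMod p}
    (hx : ReducesTo x a) (hy : ReducesTo y b) (hb : b ≠ 0) (h : a = c * b) :
    ReducesTo (x / y) c := by
  have := hx.div hy hb
  rwa [h, mul_div_cancel_right₀ _ hb] at this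

end Denominators

/-! ### The first solution -/

namespace SolutionOne

section Identities

variable {K : Type*} [Field K]

lemma kubertCubic_x {r : K} (hr : r - 3 ≠ 0) :
    kubertCubic r (x r) = (8 * r ^ 2 / (r - 3) ^ 2) ^ 2 * (r ^ 2 - 15 * r + 36) := by
  rw [kubertCubic, x]
  field_simp
  ring

lemma kubertCubic_xOfU {k : K} (hk : rDen k ≠ 0) :
    kubertCubic (r k) (xOfU k) =
      (4 * (k - 1) ^ 2 * (k ^ 2 - 4) * (k + 2) / rDen k ^ 3) ^ 2 * (17 * k ^ 2 - 16 * k) := by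
  refine kubertCubic_div_eq hk ?_
  rw [u, rNum, rDen]
  ring

lemma rDen_k {s : K} (hs : kDen s ≠ 0) : rDen (k s) = rDenOfS s / kDen s ^ 2 := by
  rw [rDen, k, rDenOfS]
  field_simp

lemma rDenOfS_ne_zero {s : K} (hs : kDen s ≠ 0) (hk : rDen (k s) ≠ 0) : rDenOfS s ≠ 0 := by
  rw [rDen_k hs] at hk
  exact fun h => hk (by rw [h, zero_div])

lemma r_k {s : K} (hs : kDen s ≠ 0) :
    r (k s) = (3 * kNum s ^ 2 - 12 * kDen s ^ 2) / rDenOfS s := by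
  rw [r, rDen_k hs, rNum, k]
  field_simp

lemma kubertCubic_xOfH {s : K} (hs : kDen s ≠ 0) (hk : rDen (k s) ≠ 0) :
    kubertCubic (r (k s)) (xOfH s) =
      (16 * (s - 5) ^ 2 * (s + 3) * (s + 7) ^ 2 * (3 * s - 11) * (s ^ 2 - s - 8) ^ 2 * (s - 1) /
        rDenOfS s ^ 3) ^ 2 * (33 * s ^ 2 - 34 * s - 255) := by
  rw [r_k hs]
  refine kubertCubic_div_eq (rDenOfS_ne_zero hs hk) ?_
  rw [h, rDenOfS, kNum, kDen]
  ring

lemma conic_r {k : K} (hk : rDen k ≠ 0) :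
    r k ^ 2 - 15 * r k + 36 = (9 * k / rDen k) ^ 2 := by
  rw [r]
  field_simp
  rw [rNum, rDen]
  ring

lemma conic_k {s : K} (hs : kDen s ≠ 0) :
    17 * k s ^ 2 - 16 * k s = ((s - 1) * (s - 17) / kDen s) ^ 2 := by
  rw [k]
  field_simp
  rw [kNum, kDen]
  ring

lemma conic_s {t : K} (ht : sDen t ≠ 0) :
    33 * s t ^ 2 - 34 * s t - 255 = ((20 * t ^ 2 - 296 * t + 660) / sDen t) ^ 2 := by
  rw [s]
  field_simp
  rw [sNum, sDen]
  ring

lemma isSquare_kubertCubic_xs {t : K} (ht : Admissible t) (i : Fin 3) :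
    IsSquare (kubertCubic (rOfT t) (xs t i)) := by
  obtain ⟨hs, hk, hr, h3, -⟩ := ht
  fin_cases i
  · change IsSquare (kubertCubic (rOfT t) (x (rOfT t)))
    rw [kubertCubic_x h3, rOfT, conic_r hr, ← mul_pow]
    exact IsSquare.sq _
  · change IsSquare (kubertCubic (rOfT t) (xOfU (k (s t))))
    rw [rOfT, kubertCubic_xOfU hr, conic_k hk, ← mul_pow]
    exact IsSquare.sq _
  · change IsSquare (kubertCubic (rOfT t) (xOfH (s t)))
    rw [rOfT, kubertCubic_xOfH hk hr, conic_s hs, ← mul_pow]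
    exact IsSquare.sq _

variable {L : Type*} [Field L] (ι : K →+* L)

lemma map_sDen (t : K) : ι (sDen t) = sDen (ι t) := by
  simp only [sDen, map_sub, map_pow, map_ofNat]

lemma map_s (t : K) : ι (s t) = s (ι t) := by
  simp only [s, sNum, map_sDen, map_div₀, map_add, map_sub, map_mul, map_pow, map_ofNat]

lemma map_kDen (s : K) : ι (kDen s) = kDen (ι s) := by
  simp only [kDen, map_sub, map_pow, map_ofNat]

lemma map_k (s : K) : ι (k s) = k (ι s) := by
  simp only [k, kNum, map_kDen, map_div₀, map_sub, map_pow, map_one]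

lemma map_rDen (k : K) : ι (rDen k) = rDen (ι k) := by
  simp only [rDen, map_sub, map_pow, map_one]

lemma map_r (k : K) : ι (r k) = r (ι k) := by
  simp only [r, rNum, map_rDen, map_div₀, map_sub, map_mul, map_pow, map_ofNat]

lemma map_rOfT (t : K) : ι (rOfT t) = rOfT (ι t) := by
  rw [rOfT, rOfT, map_r, map_k, map_s]

lemma map_xs (t : K) (i : Fin 3) : ι (xs t i) = xs (ι t) i := by
  fin_cases i
  · change ι (x (rOfT t)) = x (rOfT (ι t))
    simp only [x, ← map_rOfT, map_div₀, map_sub, map_mul, map_neg, map_ofNat]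
  · change ι (xOfU (k (s t))) = xOfU (k (s (ι t)))
    simp only [xOfU, u, ← map_s, ← map_k, map_rDen, map_div₀, map_sub, map_mul, map_pow, map_one,
      map_ofNat]
  · change ι (xOfH (s t)) = xOfH (s (ι t))
    simp only [xOfH, h, rDenOfS, kNum, kDen, ← map_s, map_div₀, map_add, map_sub, map_mul, map_pow,
      map_one, map_neg, map_ofNat]

lemma admissible_of_map {t : K} (ht : Admissible (ι t)) : Admissible t := by
  simpa only [Admissible, ← map_s, ← map_k, ← map_rOfT, ← map_sDen, ← map_kDen, ← map_rDen,
    ← map_ofNat ι 3, ← map_sub, map_ne_zero] using ht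

end Identities

section Parametrizations

lemma parametrizesConic_r : ParametrizesConic 1 (-15) 36 {3} rNum rDen := by
  intro v hv
  have hv3 : v - 3 ≠ 0 := sub_ne_zero.2 hv
  constructor
  · rintro ⟨d, hd⟩
    -- On the conic, `(r - 3)(r - 12) = d²` gives `k² = (r - 12) / (r - 3) = (d / (r - 3))²`.
    have hden : rDen (d / (v - 3)) = -9 / (v - 3) := by
      rw [rDen, div_pow, ← hd]
      field_simp
      ring
    have hnum : rNum (d / (v - 3)) = -9 * v / (v - 3) := by
      rw [rNum, div_pow, ← hd]
      field_simp
      ring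
    refine ⟨d / (v - 3), ?_, ?_⟩
    · rw [hden]
      exact div_ne_zero (by norm_num) hv3
    · rw [hden, hnum]
      field_simp
  · rintro ⟨k, hk, rfl⟩
    exact ⟨9 * k / rDen k, by rw [← conic_r hk, r]; ring⟩

lemma parametrizesConic_k : ParametrizesConic 17 (-16) 0 ∅ kNum kDen := by
  have hden : ∀ s : ℚ, kDen s ≠ 0 := by
    intro s hs
    refine not_isSquare_of_lt_of_lt (n := 17) (m := 4) (by simp) (by simp) ⟨s, ?_⟩
    rw [kDen] at hs
    push_cast
    linear_combination -hs
  intro v _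
  constructor
  · rintro ⟨d, hd⟩
    by_cases h1 : v = 1
    · exact ⟨9, hden 9, by rw [h1, kNum, kDen]; norm_num⟩
    · have h1' : 1 - v ≠ 0 := sub_ne_zero.2 (Ne.symm h1)
      -- A root of `(1 - v) s² - 2 s + 1 + 17 v = 0`, by the quadratic formula.
      refine ⟨(1 + d) / (1 - v), hden _, ?_⟩
      rw [eq_div_iff (hden _), kNum, kDen]
      field_simp
      linear_combination (1 - v) * hd
  · rintro ⟨s, hs, rfl⟩
    exact ⟨(s - 1) * (s - 17) / kDen s, by rw [← conic_k hs, k]; ring⟩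

lemma parametrizesConic_s : ParametrizesConic 33 (-34) (-255) ∅ sNum sDen := by
  have hden : ∀ t : ℚ, sDen t ≠ 0 := by
    intro t ht
    refine not_isSquare_of_lt_of_lt (n := 33) (m := 5) (by simp) (by simp) ⟨t, ?_⟩
    rw [sDen] at ht
    push_cast
    linear_combination -ht
  intro v _
  constructor
  · rintro ⟨d, hd⟩
    by_cases h5 : v = 5
    · exact ⟨37 / 5, hden _, by rw [h5, sNum, sDen]; norm_num⟩
    · have h5' : 5 - v ≠ 0 := sub_ne_zero.2 (Ne.symm h5)
      -- A root of `(5 - v) t² - 40 t + 131 + 33 v = 0`, by the quadratic formula.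
      refine ⟨(20 + d) / (5 - v), hden _, ?_⟩
      rw [eq_div_iff (hden _), sNum, sDen]
      field_simp
      linear_combination (5 - v) * hd
  · rintro ⟨t, ht, rfl⟩
    exact ⟨(20 * t ^ 2 - 296 * t + 660) / sDen t, by rw [← conic_s ht, s]; ring⟩

lemma isSquareTimesQuadratic_r :
    IsSquareTimesQuadratic (kubertCubic RatFunc.X (x RatFunc.X)) 1 (-15) 36 := by
  have h := ratFunc_algebraMap_ne_zero (f := Polynomial.X - 3) (c := 0) (by simp)
  simp only [map_sub, RatFunc.algebraMap_X, map_ofNat] at h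
  refine ⟨8 * RatFunc.X ^ 2 / (RatFunc.X - 3) ^ 2, ?_⟩
  rw [kubertCubic_x h]
  simp only [map_neg, map_one, map_ofNat]
  ring

lemma isSquareTimesQuadratic_k :
    IsSquareTimesQuadratic (kubertCubic (r RatFunc.X) (xOfU RatFunc.X)) 17 (-16) 0 := by
  have h := ratFunc_algebraMap_ne_zero (f := Polynomial.X ^ 2 - 1) (c := 0) (by simp)
  simp only [map_sub, map_pow, RatFunc.algebraMap_X, map_one] at h
  refine ⟨4 * (RatFunc.X - 1) ^ 2 * (RatFunc.X ^ 2 - 4) * (RatFunc.X + 2) / rDen RatFunc.X ^ 3, ?_⟩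
  rw [kubertCubic_xOfU h]
  simp only [map_neg, map_zero, map_ofNat]
  ring

lemma isSquareTimesQuadratic_s :
    IsSquareTimesQuadratic (kubertCubic (r (k RatFunc.X)) (xOfH RatFunc.X)) 33 (-34) (-255) := by
  have hs := ratFunc_algebraMap_ne_zero (f := Polynomial.X ^ 2 - 17) (c := 0) (by simp)
  have hk := ratFunc_algebraMap_ne_zero
    (f := ((Polynomial.X - 1) ^ 2) ^ 2 - (Polynomial.X ^ 2 - 17) ^ 2) (c := 0) (by norm_num)
  simp only [map_sub, map_pow, RatFunc.algebraMap_X, map_one, map_ofNat] at hs hk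
  refine ⟨16 * (RatFunc.X - 5) ^ 2 * (RatFunc.X + 3) * (RatFunc.X + 7) ^ 2 * (3 * RatFunc.X - 11) *
    (RatFunc.X ^ 2 - RatFunc.X - 8) ^ 2 * (RatFunc.X - 1) / rDenOfS RatFunc.X ^ 3, ?_⟩
  rw [kubertCubic_xOfH hs (by rw [rDen_k hs]; exact div_ne_zero hk (pow_ne_zero _ hs))]
  simp only [map_neg, map_ofNat]
  ring

end Parametrizations

section Specialization

/-- The residue classes of the parameter and of the three `x`-coordinates, computed step by step
from the residue class of `t`. -/
lemma reducesTo_xs {p : ℕ} [Fact p.Prime] {t : ℚ_[p]} {c s₀ k₀ r₀ x₁ x₂ x₃ : ZMod p}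
    (ht : ReducesTo t c) (hs : sDen c ≠ 0 ∧ sNum c = s₀ * sDen c)
    (hk : kDen s₀ ≠ 0 ∧ kNum s₀ = k₀ * kDen s₀) (hr : rDen k₀ ≠ 0 ∧ rNum k₀ = r₀ * rDen k₀)
    (h₁ : r₀ - 3 ≠ 0 ∧ -12 * r₀ = x₁ * (r₀ - 3)) (h₂ : u k₀ = x₂ * rDen k₀ ^ 2)
    (h₃ : rDenOfS s₀ ≠ 0 ∧ h s₀ = x₃ * rDenOfS s₀ ^ 2) :
    ReducesTo (rOfT t) r₀ ∧ ReducesTo (xs t 0) x₁ ∧ ReducesTo (xs t 1) x₂ ∧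
      ReducesTo (xs t 2) x₃ := by
  have hsR : ReducesTo (s t) s₀ :=
    (show ReducesTo (sNum t) (sNum c) from
      (((ReducesTo.ofNat 5).mul (ht.pow 2)).sub ((ReducesTo.ofNat 40).mul ht)).add
        (.ofNat 131)).div_of_eq_mul
      (show ReducesTo (sDen t) (sDen c) from (ht.pow 2).sub (.ofNat 33)) hs.1 hs.2
  have hkN : ReducesTo (kNum (s t)) (kNum s₀) := (hsR.sub .one).pow 2
  have hkD : ReducesTo (kDen (s t)) (kDen s₀) := (hsR.pow 2).sub (.ofNat 17)
  have hkR : ReducesTo (k (s t)) k₀ := hkN.div_of_eq_mul hkD hk.1 hk.2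
  have hrD : ReducesTo (rDen (k (s t))) (rDen k₀) := (hkR.pow 2).sub .one
  have hrR : ReducesTo (rOfT t) r₀ :=
    (show ReducesTo (rNum (k (s t))) (rNum k₀) from
      ((ReducesTo.ofNat 3).mul (hkR.pow 2)).sub (.ofNat 12)).div_of_eq_mul hrD hr.1 hr.2
  refine ⟨hrR, ?_, ?_, ?_⟩
  · exact ((ReducesTo.ofNat 12).neg.mul hrR).div_of_eq_mul (hrR.sub (.ofNat 3)) h₁.1 h₁.2
  · exact (((ReducesTo.ofNat 4).mul ((hkR.pow 2).sub (.ofNat 4))).mul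
      ((hkR.sub .one).pow 2)).div_of_eq_mul (hrD.pow 2) (pow_ne_zero _ hr.1) h₂
  · exact ((((((ReducesTo.ofNat 16).neg.mul (hsR.sub (.ofNat 5))).mul (hsR.add (.ofNat 3))).mul
      (hsR.add (.ofNat 7))).mul (((ReducesTo.ofNat 3).mul hsR).sub (.ofNat 11))).mul
      ((((hsR.pow 2).sub hsR).sub (.ofNat 8)).pow 2)).div_of_eq_mul
      (((hkN.pow 2).sub (hkD.pow 2)).pow 2) (pow_ne_zero _ h₃.1) h₃.2

/-- For `t ≡ 3` modulo `16`, the number `k` is half of a 2-adic unit, so `r` is a unit. -/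
lemma padic_unit_rOfT {t : ℚ_[2]} {z : ℤ_[2]} (ht : t = 3 + 16 * z) :
    Admissible t ∧ ‖rOfT t‖ = 1 := by
  -- With these numbers `s = N / D` and `k = A² / (2M)`, and `D`, `A`, `M` are units.
  obtain ⟨N, hN⟩ : ∃ N : ℚ_[2], N = 7 - 20 * z + 160 * z ^ 2 := ⟨_, rfl⟩
  obtain ⟨D, hD⟩ : ∃ D : ℚ_[2], D = -3 + 12 * z + 32 * z ^ 2 := ⟨_, rfl⟩
  obtain ⟨A, hA⟩ : ∃ A : ℚ_[2], A = 5 - 16 * z + 64 * z ^ 2 := ⟨_, rfl⟩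
  obtain ⟨M, hM⟩ : ∃ M : ℚ_[2],
      M = -13 + 118 * z + 432 * z ^ 2 - 2432 * z ^ 3 + 1024 * z ^ 4 := ⟨_, rfl⟩
  have hD1 : ‖D‖ = 1 := by
    refine padic_norm_odd (-2 + 6 * z + 16 * z ^ 2) ?_
    rw [hD]
    simp only [map_add, map_mul, map_neg, map_pow, map_ofNat, padicInt_coe_ringHom_apply]
    ring
  have hA1 : ‖A‖ = 1 := by
    refine padic_norm_odd (2 - 8 * z + 32 * z ^ 2) ?_
    rw [hA]
    simp only [map_add, map_sub, map_mul, map_pow, map_ofNat, padicInt_coe_ringHom_apply]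
    ring
  have hM1 : ‖M‖ = 1 := by
    refine padic_norm_odd (-7 + 59 * z + 216 * z ^ 2 - 1216 * z ^ 3 + 512 * z ^ 4) ?_
    rw [hM]
    simp only [map_add, map_sub, map_mul, map_neg, map_pow, map_ofNat, padicInt_coe_ringHom_apply]
    ring
  have hD0 : D ≠ 0 := norm_ne_zero_iff.1 (by rw [hD1]; norm_num)
  have hM0 : M ≠ 0 := norm_ne_zero_iff.1 (by rw [hM1]; norm_num)
  have hsD : sDen t = 8 * D := by rw [sDen, ht, hD]; ring
  have hs : s t = N / D := by
    rw [s, hsD, show sNum t = 8 * N by rw [sNum, ht, hN]; ring]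
    exact mul_div_mul_left _ _ (by norm_num)
  have hkD : kDen (s t) = 8 * M / D ^ 2 := by
    rw [kDen, hs, eq_div_iff (pow_ne_zero _ hD0), sub_mul, div_pow,
      div_mul_cancel₀ _ (pow_ne_zero _ hD0), hN, hD, hM]
    ring
  have hkN : kNum (s t) = 4 * A ^ 2 / D ^ 2 := by
    rw [kNum, hs, div_sub_one hD0, div_pow, show N - D = 2 * A by rw [hN, hD, hA]; ring]
    ring
  have hk : k (s t) = A ^ 2 / (2 * M) := by
    rw [k, hkD, hkN]
    field_simp
    ring
  have hAM : ∀ c : ℤ_[2], ‖A ^ 4 - 2 * c * M ^ 2‖ = 1 := by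
    intro c
    have h1 : ‖A ^ 4‖ = 1 := by rw [norm_pow, hA1, one_pow]
    have h2 : ‖2 * (c : ℚ_[2]) * M ^ 2‖ < 1 := by
      rw [norm_mul, norm_mul, norm_pow, hM1, padic_norm_two]
      have : ‖(c : ℚ_[2])‖ ≤ 1 := c.2
      linarith
    rw [sub_eq_add_neg, padic_norm_add_eq_left (by rw [norm_neg, h1]; exact h2), h1]
  have hB1 : ‖A ^ 4 - 4 * M ^ 2‖ = 1 := by
    rw [← hAM 2, ← padicInt_coe_ringHom_apply, map_ofNat]; ring_nf
  have hC1 : ‖A ^ 4 - 16 * M ^ 2‖ = 1 := by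
    rw [← hAM 8, ← padicInt_coe_ringHom_apply, map_ofNat]; ring_nf
  have hB0 : A ^ 4 - 4 * M ^ 2 ≠ 0 := norm_ne_zero_iff.1 (by rw [hB1]; norm_num)
  have hrD : rDen (k (s t)) = (A ^ 4 - 4 * M ^ 2) / (4 * M ^ 2) := by
    rw [rDen, hk]
    field_simp
    ring
  have hr : rOfT t = 3 * (A ^ 4 - 16 * M ^ 2) / (A ^ 4 - 4 * M ^ 2) := by
    rw [rOfT, r, hrD, rNum, hk]
    field_simp
    ring
  have h3 : ‖(3 : ℚ_[2])‖ = 1 := by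
    exact padic_norm_odd 1 (by rw [map_one]; norm_num)
  have hr1 : ‖rOfT t‖ = 1 := by
    rw [hr, norm_div, norm_mul, hB1, hC1, h3]; norm_num
  have h8 : (8 : ℚ_[2]) ≠ 0 := by norm_num
  have h4 : (4 : ℚ_[2]) ≠ 0 := by norm_num
  refine ⟨⟨?_, ?_, ?_, ?_, ?_⟩, hr1⟩
  · rw [hsD]; exact mul_ne_zero h8 hD0
  · rw [hkD]; exact div_ne_zero (mul_ne_zero h8 hM0) (pow_ne_zero _ hD0)
  · rw [hrD]; exact div_ne_zero hB0 (mul_ne_zero h4 (pow_ne_zero _ hM0))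
  · rw [hr, div_sub' hB0]
    refine div_ne_zero ?_ hB0
    rw [show 3 * (A ^ 4 - 16 * M ^ 2) - (A ^ 4 - 4 * M ^ 2) * 3 = -36 * M ^ 2 by ring]
    exact mul_ne_zero (by norm_num) (pow_ne_zero _ hM0)
  · exact norm_ne_zero_iff.1 (by rw [hr1]; norm_num)

end Specialization

end SolutionOne

/-! ### Torsion and independence in the first solution -/

instance fact_prime_seventeen : Fact (Nat.Prime 17) := ⟨by norm_num⟩
instance fact_prime_nineteen : Fact (Nat.Prime 19) := ⟨by norm_num⟩
instance fact_prime_thirty_one : Fact (Nat.Prime 31) := ⟨by norm_num⟩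

namespace SolutionOne

section RankThree

/-- The three congruences force torsion subgroup `ℤ/5ℤ` (by the one modulo `16`) and independence of
the three points (by the other two, which provide the three quadratic characters). -/
lemma members_of_congruences {K : Type*} [Field K] [CharZero K] [DecidableEq K] {t : K}
    (ι₂ : K →+* ℚ_[2]) {z : ℤ_[2]} (h₂ : ι₂ t = 3 + 16 * z)
    (ι₁₇ : K →+* ℚ_[17]) (h₁₇ : ReducesTo (ι₁₇ t) 0)
    (ι₃₁ : K →+* ℚ_[31]) (h₃₁ : ReducesTo (ι₃₁ t) 3) :
    Admissible t ∧ (kubertCurve (rOfT t)).IsElliptic ∧ TorsionIsZMod5 (kubertCurve (rOfT t)) ∧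
      HasIndependentPoints (kubertCurve (rOfT t)) (xs t) := by
  obtain ⟨hadm₂, hu⟩ := padic_unit_rOfT h₂
  have hadm : Admissible t := admissible_of_map ι₂ hadm₂
  rw [← map_rOfT] at hu
  have hE := kubertCurve_isElliptic_of_padic_unit ι₂ hu
  have htor := torsionIsZMod5_of_padic_unit hu
  obtain ⟨r₁, a₀, a₁, a₂⟩ := reducesTo_xs (s₀ := 12) (k₀ := 13) (r₀ := 16) (x₁ := 14) (x₂ := 11)
    (x₃ := 6) h₁₇ (by decide) (by decide) (by decide) (by decide) (by decide) (by decide)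
  obtain ⟨r₂, b₀, b₁, b₂⟩ := reducesTo_xs (s₀ := 8) (k₀ := 5) (r₀ := 22) (x₁ := 22) (x₂ := 23)
    (x₃ := 13) h₃₁ (by decide) (by decide) (by decide) (by decide) (by decide) (by decide)
  rw [← map_rOfT] at r₁ r₂
  rw [← map_xs] at a₀ a₁ a₂ b₀ b₁ b₂
  choose P hP using fun i => exists_hasXCoord (isSquare_kubertCubic_xs hadm i)
  obtain ⟨H₀, d₀, -, n₀⟩ := exists_descent_subgroup htor (by decide) ι₁₇ r₁ (b := 4)
    (by decide) (by decide)
  obtain ⟨H₁, d₁, m₁, n₁⟩ := exists_descent_subgroup htor (by decide) ι₃₁ r₂ (b := 12)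
    (by decide) (by decide)
  obtain ⟨H₂, d₂, m₂, n₂⟩ := exists_descent_subgroup htor (by decide) ι₃₁ r₂ (b := 21)
    (by decide) (by decide)
  exact ⟨hadm, hE, htor, P, hP, linearIndependent_of_subgroups
    (fun _ => eq_zero_of_two_nsmul_eq_zero htor) P H₀ H₁ H₂ d₀ d₁ d₂
    (n₀ _ _ _ (hP 0) a₀ (by decide))
    (m₁ _ _ _ 14 (hP 0) b₀ (by decide) (by decide)) (n₁ _ _ _ (hP 1) b₁ (by decide))
    (m₂ _ _ _ 1 (hP 0) b₀ (by decide) (by decide)) (m₂ _ _ _ 8 (hP 1) b₁ (by decide) (by decide))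
    (n₂ _ _ _ (hP 2) b₂ (by decide))⟩

lemma isGenericRankThreeFamily [DecidableEq (RatFunc ℚ)] :
    IsGenericRankThreeFamily (rOfT RatFunc.X) (xs RatFunc.X) := by
  obtain ⟨ι₂, z₂, h₂⟩ := exists_ratFunc_embedding 2 3 4
  obtain ⟨ι₁₇, z₁₇, h₁₇⟩ := exists_ratFunc_embedding 17 0 1
  obtain ⟨ι₃₁, z₃₁, h₃₁⟩ := exists_ratFunc_embedding 31 3 1
  obtain ⟨-, hE, htor, hind⟩ := members_of_congruences ι₂ (z := z₂) (by rw [h₂]; norm_num)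
    ι₁₇ (by simpa using reducesTo_of_eq h₁₇) ι₃₁ (by simpa using reducesTo_of_eq h₃₁)
  exact ⟨hE, htor, hind, three_le_rank_of_hasIndependentPoints hind⟩

lemma everyMemberHasPoints : EveryMemberHasPoints Admissible rOfT xs :=
  everyMemberHasPoints_of_isSquare (fun _ ht => ht.2.2.2.2)
    fun _ ht => isSquare_kubertCubic_xs ht

lemma finite_fibre_rOfT (r₀ : ℚ) : {t : ℚ | Admissible t ∧ rOfT t = r₀}.Finite := by
  have hr : ∀ v : ℚ, {k : ℚ | rDen k ≠ 0 ∧ rNum k / rDen k = v}.Finite := fun v =>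
    finite_fibre_of_quadratic (a := 3 - v) (b := 0) (c := v - 12)
      (by by_cases h : v = 12 <;> [left; (right; right)] <;> grind)
      (fun k => by rw [rNum, rDen]; ring)
  have hk : ∀ v : ℚ, {s : ℚ | kDen s ≠ 0 ∧ kNum s / kDen s = v}.Finite := fun v =>
    finite_fibre_of_quadratic (a := 1 - v) (b := -2) (c := 1 + 17 * v) (by norm_num)
      (fun s => by rw [kNum, kDen]; ring)
  have hs : ∀ v : ℚ, {t : ℚ | sDen t ≠ 0 ∧ sNum t / sDen t = v}.Finite := fun v =>
    finite_fibre_of_quadratic (a := 5 - v) (b := -40) (c := 131 + 33 * v) (by norm_num)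
      (fun t => by rw [sNum, sDen]; ring)
  refine ((hr r₀).biUnion fun k _ => (hk k).biUnion fun s _ => hs s).subset ?_
  rintro t ⟨⟨h₁, h₂, h₃, -⟩, h⟩
  simp only [Set.mem_iUnion]
  exact ⟨k (s t), ⟨h₃, h⟩, s t, ⟨h₂, rfl⟩, h₁, rfl⟩

lemma infinitelyManyRankThreeMembers : InfinitelyManyRankThreeMembers Admissible rOfT xs := by
  -- An arithmetic progression inside the classes `3` mod `16`, `0` mod `17` and `3` mod `31`.
  refine infinitelyManyRankThreeMembers_of_injective (t := fun n : ℕ => 7939 + 8432 * (n : ℚ))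
    (fun m n h => by simpa using h) finite_fibre_rOfT fun n => ?_
  refine members_of_congruences (Rat.castHom ℚ_[2]) (z := ((496 + 527 * n : ℕ) : ℤ_[2])) ?_
    (Rat.castHom ℚ_[17]) ?_ (Rat.castHom ℚ_[31]) ?_
  · rw [PadicInt.coe_natCast]
    simp only [map_add, map_mul, map_ofNat, map_natCast]
    push_cast
    ring
  · refine reducesTo_of_eq (c := 0) (z := ((467 + 496 * n : ℕ) : ℤ_[17])) ?_
    rw [PadicInt.coe_natCast]
    simp only [map_add, map_mul, map_ofNat, map_natCast]
    push_cast
    ring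
  · refine reducesTo_of_eq (c := 3) (z := ((256 + 272 * n : ℕ) : ℤ_[31])) ?_
    rw [PadicInt.coe_natCast]
    simp only [map_add, map_mul, map_ofNat, map_natCast]
    push_cast
    ring

end RankThree

end SolutionOne

/-! ### The second solution -/

namespace SolutionTwo

section Identities

variable {K : Type*} [Field K]

lemma kubertCubic_x {r : K} (hr : 1 - 3 * r ≠ 0) :
    kubertCubic r (x r) = (8 * r ^ 2 / (1 - 3 * r) ^ 2) ^ 2 * (9 * r ^ 2 - 15 * r + 4) := by
  rw [kubertCubic, x]
  obtain ⟨d, hd⟩ : ∃ d, d = 1 - 3 * r := ⟨_, rfl⟩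
  rw [← hd] at hr ⊢
  field_simp
  rw [hd]
  ring

lemma kubertCubic_xOfU {k : K} (hk : rDen k ≠ 0) :
    kubertCubic (r k) (xOfU k) =
      (4 * (k ^ 5 - 252 * k ^ 3 + 432 * k ^ 2 + 15552 * k - 62208) / rDen k ^ 3) ^ 2 *
        (41 * k ^ 2 + 480 * k) := by
  refine kubertCubic_div_eq hk ?_
  rw [u, rNum, rDen]
  ring

lemma rDen_k {s : K} (hs : kDen s ≠ 0) : rDen (k s) = rDenOfS s / kDen s ^ 2 := by
  rw [rDen, k, rDenOfS]
  field_simp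

lemma rDenOfS_ne_zero {s : K} (hs : kDen s ≠ 0) (hk : rDen (k s) ≠ 0) : rDenOfS s ≠ 0 := by
  rw [rDen_k hs] at hk
  exact fun h => hk (by rw [h, zero_div])

lemma r_k {s : K} (hs : kDen s ≠ 0) :
    r (k s) = (kNum s ^ 2 - 144 * kDen s ^ 2) / rDenOfS s := by
  rw [r, rDen_k hs, rNum, k]
  field_simp

lemma kubertCubic_xOfH {s : K} (hs : kDen s ≠ 0) (hk : rDen (k s) ≠ 0) :
    kubertCubic (r (k s)) (xOfH s) =
      (23887872 * (s - 4) * (s - 5) * (9 * s - 61) ^ 2 * (3 * s ^ 2 - 36 * s + 121) ^ 2 * (s - 9) /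
        rDenOfS s ^ 3) ^ 2 * (s ^ 2 - 738 * s + 4961) := by
  rw [r_k hs]
  refine kubertCubic_div_eq (rDenOfS_ne_zero hs hk) ?_
  rw [h, rDenOfS, kNum, kDen]
  ring

lemma conic_r {k : K} (hk : rDen k ≠ 0) :
    9 * r k ^ 2 - 15 * r k + 4 = (54 * k / rDen k) ^ 2 := by
  rw [r]
  field_simp
  rw [rNum, rDen]
  ring

lemma conic_k {s : K} (hs : kDen s ≠ 0) :
    41 * k s ^ 2 + 480 * k s = (12 * (s - 9) * (9 * s - 41) / kDen s) ^ 2 := by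
  rw [k]
  field_simp
  rw [kNum, kDen]
  ring

lemma conic_s {t : K} (ht : sDen t ≠ 0) :
    s t ^ 2 - 738 * s t + 4961 = ((206 * t ^ 2 + 2212 * t + 206) / sDen t) ^ 2 := by
  rw [s]
  field_simp
  rw [sNum, sDen]
  ring

lemma isSquare_kubertCubic_xs {t : K} (ht : Admissible t) (i : Fin 3) :
    IsSquare (kubertCubic (rOfT t) (xs t i)) := by
  obtain ⟨hs, hk, hr, h3, -⟩ := ht
  fin_cases i
  · change IsSquare (kubertCubic (rOfT t) (x (rOfT t)))
    rw [kubertCubic_x h3, rOfT, conic_r hr, ← mul_pow]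
    exact IsSquare.sq _
  · change IsSquare (kubertCubic (rOfT t) (xOfU (k (s t))))
    rw [rOfT, kubertCubic_xOfU hr, conic_k hk, ← mul_pow]
    exact IsSquare.sq _
  · change IsSquare (kubertCubic (rOfT t) (xOfH (s t)))
    rw [rOfT, kubertCubic_xOfH hk hr, conic_s hs, ← mul_pow]
    exact IsSquare.sq _

variable {L : Type*} [Field L] (ι : K →+* L)

lemma map_sDen (t : K) : ι (sDen t) = sDen (ι t) := by
  simp only [sDen, map_sub, map_mul, map_pow, map_ofNat]

lemma map_s (t : K) : ι (s t) = s (ι t) := by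
  simp only [s, sNum, map_sDen, map_div₀, map_sub, map_mul, map_pow, map_ofNat]

lemma map_kDen (s : K) : ι (kDen s) = kDen (ι s) := by
  simp only [kDen, map_sub, map_pow, map_ofNat]

lemma map_k (s : K) : ι (k s) = k (ι s) := by
  simp only [k, kNum, map_kDen, map_div₀, map_add, map_sub, map_mul, map_pow, map_ofNat]

lemma map_rDen (k : K) : ι (rDen k) = rDen (ι k) := by
  simp only [rDen, map_sub, map_mul, map_pow, map_ofNat]

lemma map_r (k : K) : ι (r k) = r (ι k) := by
  simp only [r, rNum, map_rDen, map_div₀, map_sub, map_pow, map_ofNat]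

lemma map_rOfT (t : K) : ι (rOfT t) = rOfT (ι t) := by
  rw [rOfT, rOfT, map_r, map_k, map_s]

lemma map_xs (t : K) (i : Fin 3) : ι (xs t i) = xs (ι t) i := by
  fin_cases i
  · change ι (x (rOfT t)) = x (rOfT (ι t))
    simp only [x, ← map_rOfT, map_div₀, map_sub, map_mul, map_one, map_ofNat]
  · change ι (xOfU (k (s t))) = xOfU (k (s (ι t)))
    simp only [xOfU, u, ← map_s, ← map_k, map_rDen, map_div₀, map_sub, map_mul, map_pow,
      map_ofNat]
  · change ι (xOfH (s t)) = xOfH (s (ι t))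
    simp only [xOfH, h, rDenOfS, kNum, kDen, ← map_s, map_div₀, map_add, map_sub, map_mul, map_pow,
      map_neg, map_ofNat]

lemma admissible_of_map {t : K} (ht : Admissible (ι t)) : Admissible t := by
  simpa only [Admissible, ← map_s, ← map_k, ← map_rOfT, ← map_sDen, ← map_kDen, ← map_rDen,
    ← map_ofNat ι 3, ← map_one ι, ← map_mul, ← map_sub, map_ne_zero] using ht

end Identities

section Parametrizations

lemma parametrizesConic_r : ParametrizesConic 9 (-15) 4 {1 / 3} rNum rDen := by
  intro v hv
  have hv3 : 3 * v - 1 ≠ 0 := fun h => hv (by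
    rw [Set.mem_singleton_iff]; linear_combination (1 / 3 : ℚ) * h)
  constructor
  · rintro ⟨d, hd⟩
    obtain ⟨e, he⟩ : ∃ e, e = 3 * v - 1 := ⟨_, rfl⟩
    rw [← he] at hv3
    -- On the conic, `(3r - 1)(3r - 4) = d²` gives `k² = 36 (3r - 4) / (3r - 1)`.
    have hden : rDen (6 * d / e) = -324 / e := by
      rw [rDen, div_pow, mul_pow, ← hd]
      field_simp
      rw [he]
      ring
    have hnum : rNum (6 * d / e) = -324 * v / e := by
      rw [rNum, div_pow, mul_pow, ← hd]
      field_simp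
      rw [he]
      ring
    refine ⟨6 * d / e, ?_, ?_⟩
    · rw [hden]
      exact div_ne_zero (by norm_num) hv3
    · rw [hden, hnum]
      field_simp
  · rintro ⟨k, hk, rfl⟩
    exact ⟨54 * k / rDen k, by rw [← conic_r hk, r]; ring⟩

lemma parametrizesConic_k : ParametrizesConic 41 480 0 ∅ kNum kDen := by
  have hden : ∀ s : ℚ, kDen s ≠ 0 := by
    intro s hs
    refine not_isSquare_of_lt_of_lt (n := 41) (m := 6) (by simp) (by simp) ⟨s, ?_⟩
    rw [kDen] at hs
    push_cast
    linear_combination -hs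
  intro v _
  constructor
  · rintro ⟨d, hd⟩
    by_cases h1 : v = 12
    · exact ⟨61 / 9, hden _, by rw [h1, kNum, kDen]; norm_num⟩
    · have h1' : 12 - v ≠ 0 := sub_ne_zero.2 (Ne.symm h1)
      -- A root of `(12 - v) s² - 216 s + 972 + 41 v = 0`, by the quadratic formula.
      refine ⟨(108 + d) / (12 - v), hden _, ?_⟩
      rw [eq_div_iff (hden _), kNum, kDen]
      field_simp
      linear_combination (12 - v) * hd
  · rintro ⟨s, hs, rfl⟩
    exact ⟨12 * (s - 9) * (9 * s - 41) / kDen s, by rw [← conic_k hs, k]; ring⟩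

lemma parametrizesConic_s : ParametrizesConic 1 (-738) 4961 ∅ sNum sDen := by
  intro v _
  constructor
  · rintro ⟨d, hd⟩
    obtain ⟨t, ht⟩ : ∃ t, sNum t = v * sDen t := by
      by_cases h3 : v = 1 / 3
      · exact ⟨-553 / 103, by rw [h3, sNum, sDen]; norm_num⟩
      · have h3' : 1 - 3 * v ≠ 0 := fun h => h3 (by linear_combination (-1 / 3 : ℚ) * h)
        -- A root of `(1 - 3 v) t² - 412 t - 2213 + 3 v = 0`, by the quadratic formula.
        refine ⟨(206 + 3 * d) / (1 - 3 * v), ?_⟩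
        rw [sNum, sDen]
        field_simp
        linear_combination 9 * (3 * v - 1) * hd
    -- The zeros `t = ± 1` of the denominator are not zeros of the numerator.
    have hden : sDen t ≠ 0 := by
      intro h0
      rw [h0, mul_zero] at ht
      rw [sNum] at ht
      rw [sDen] at h0
      have h1 : (t - 1) * (t + 1) = 0 := by linear_combination (1 / 3 : ℚ) * h0
      rcases mul_eq_zero.1 h1 with h | h
      · rw [sub_eq_zero.1 h] at ht
        norm_num at ht
      · rw [eq_neg_of_add_eq_zero_left h] at ht
        norm_num at ht
    exact ⟨t, hden, (eq_div_iff hden).2 ht.symm⟩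
  · rintro ⟨t, ht, rfl⟩
    exact ⟨(206 * t ^ 2 + 2212 * t + 206) / sDen t, by rw [← conic_s ht, s]; ring⟩

lemma isSquareTimesQuadratic_r :
    IsSquareTimesQuadratic (kubertCubic RatFunc.X (x RatFunc.X)) 9 (-15) 4 := by
  have h := ratFunc_algebraMap_ne_zero (f := 1 - 3 * Polynomial.X) (c := 0) (by simp)
  simp only [map_sub, map_mul, RatFunc.algebraMap_X, map_one, map_ofNat] at h
  refine ⟨8 * RatFunc.X ^ 2 / (1 - 3 * RatFunc.X) ^ 2, ?_⟩
  rw [kubertCubic_x h]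
  simp only [map_neg, map_ofNat]
  ring

lemma isSquareTimesQuadratic_k :
    IsSquareTimesQuadratic (kubertCubic (r RatFunc.X) (xOfU RatFunc.X)) 41 480 0 := by
  have h := ratFunc_algebraMap_ne_zero (f := 3 * (Polynomial.X ^ 2 - 36)) (c := 0) (by simp)
  simp only [map_sub, map_mul, map_pow, RatFunc.algebraMap_X, map_ofNat] at h
  refine ⟨4 * (RatFunc.X ^ 5 - 252 * RatFunc.X ^ 3 + 432 * RatFunc.X ^ 2 + 15552 * RatFunc.X -
    62208) / rDen RatFunc.X ^ 3, ?_⟩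
  rw [kubertCubic_xOfU h]
  simp only [map_zero, map_ofNat]
  ring

lemma isSquareTimesQuadratic_s :
    IsSquareTimesQuadratic (kubertCubic (r (k RatFunc.X)) (xOfH RatFunc.X)) 1 (-738) 4961 := by
  have hs := ratFunc_algebraMap_ne_zero (f := Polynomial.X ^ 2 - 41) (c := 0) (by simp)
  have hk := ratFunc_algebraMap_ne_zero
    (f := 3 * ((12 * (Polynomial.X ^ 2 - 18 * Polynomial.X + 81)) ^ 2 -
      36 * (Polynomial.X ^ 2 - 41) ^ 2)) (c := 0) (by norm_num)
  simp only [map_add, map_sub, map_mul, map_pow, RatFunc.algebraMap_X, map_ofNat] at hs hk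
  refine ⟨23887872 * (RatFunc.X - 4) * (RatFunc.X - 5) * (9 * RatFunc.X - 61) ^ 2 *
    (3 * RatFunc.X ^ 2 - 36 * RatFunc.X + 121) ^ 2 * (RatFunc.X - 9) / rDenOfS RatFunc.X ^ 3, ?_⟩
  rw [kubertCubic_xOfH hs (by rw [rDen_k hs]; exact div_ne_zero hk (pow_ne_zero _ hs))]
  simp only [map_neg, map_one, map_ofNat]
  ring

end Parametrizations

section Specialization

/-- The residue classes of the parameter and of the three `x`-coordinates, computed step by step
from the residue class of `t`. -/
lemma reducesTo_xs {p : ℕ} [Fact p.Prime] {t : ℚ_[p]} {c s₀ k₀ r₀ x₁ x₂ x₃ : ZMod p}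
    (ht : ReducesTo t c) (hs : sDen c ≠ 0 ∧ sNum c = s₀ * sDen c)
    (hk : kDen s₀ ≠ 0 ∧ kNum s₀ = k₀ * kDen s₀) (hr : rDen k₀ ≠ 0 ∧ rNum k₀ = r₀ * rDen k₀)
    (h₁ : 1 - 3 * r₀ ≠ 0 ∧ 4 * r₀ = x₁ * (1 - 3 * r₀)) (h₂ : u k₀ = x₂ * rDen k₀ ^ 2)
    (h₃ : rDenOfS s₀ ≠ 0 ∧ h s₀ = x₃ * rDenOfS s₀ ^ 2) :
    ReducesTo (rOfT t) r₀ ∧ ReducesTo (xs t 0) x₁ ∧ ReducesTo (xs t 1) x₂ ∧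
      ReducesTo (xs t 2) x₃ := by
  have hsR : ReducesTo (s t) s₀ :=
    (show ReducesTo (sNum t) (sNum c) from
      ((ht.pow 2).sub ((ReducesTo.ofNat 412).mul ht)).sub (.ofNat 2213)).div_of_eq_mul
      (show ReducesTo (sDen t) (sDen c) from
        ((ReducesTo.ofNat 3).mul (ht.pow 2)).sub (.ofNat 3)) hs.1 hs.2
  have hkN : ReducesTo (kNum (s t)) (kNum s₀) :=
    (ReducesTo.ofNat 12).mul (((hsR.pow 2).sub ((ReducesTo.ofNat 18).mul hsR)).add (.ofNat 81))
  have hkD : ReducesTo (kDen (s t)) (kDen s₀) := (hsR.pow 2).sub (.ofNat 41)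
  have hkR : ReducesTo (k (s t)) k₀ := hkN.div_of_eq_mul hkD hk.1 hk.2
  have hrD : ReducesTo (rDen (k (s t))) (rDen k₀) :=
    (ReducesTo.ofNat 3).mul ((hkR.pow 2).sub (.ofNat 36))
  have hrR : ReducesTo (rOfT t) r₀ :=
    (show ReducesTo (rNum (k (s t))) (rNum k₀) from
      (hkR.pow 2).sub (.ofNat 144)).div_of_eq_mul hrD hr.1 hr.2
  refine ⟨hrR, ?_, ?_, ?_⟩
  · exact ((ReducesTo.ofNat 4).mul hrR).div_of_eq_mul
      (ReducesTo.one.sub ((ReducesTo.ofNat 3).mul hrR)) h₁.1 h₁.2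
  · exact (((ReducesTo.ofNat 4).mul ((hkR.sub (.ofNat 6)).pow 2)).mul
      ((hkR.pow 2).sub (.ofNat 144))).div_of_eq_mul (hrD.pow 2) (pow_ne_zero _ hr.1) h₂
  · exact (((((ReducesTo.ofNat 82944).neg.mul (hsR.sub (.ofNat 4))).mul (hsR.sub (.ofNat 5))).mul
      (((ReducesTo.ofNat 9).mul hsR).sub (.ofNat 61))).mul
      (((((ReducesTo.ofNat 3).mul (hsR.pow 2)).sub ((ReducesTo.ofNat 36).mul hsR)).add
        (.ofNat 121)).pow 2)).div_of_eq_mul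
      (((ReducesTo.ofNat 3).mul ((hkN.pow 2).sub
        ((ReducesTo.ofNat 36).mul (hkD.pow 2)))).pow 2) (pow_ne_zero _ h₃.1) h₃.2

/-- For `t ≡ 29` modulo `128`, the number `k` is half of a 2-adic unit, so `r` is a unit. -/
lemma padic_unit_rOfT {t : ℚ_[2]} {z : ℤ_[2]} (ht : t = 29 + 128 * z) :
    Admissible t ∧ ‖rOfT t‖ = 1 := by
  -- With these numbers `s = N / D` and `k = 3A² / (2M)`, and `D`, `A`, `M` are units.
  obtain ⟨N, hN⟩ : ∃ N : ℚ_[2], N = -1665 - 5664 * z + 2048 * z ^ 2 := ⟨_, rfl⟩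
  obtain ⟨D, hD⟩ : ∃ D : ℚ_[2], D = 315 + 2784 * z + 6144 * z ^ 2 := ⟨_, rfl⟩
  obtain ⟨A, hA⟩ : ∃ A : ℚ_[2], A = 1125 + 7680 * z + 13312 * z ^ 2 := ⟨_, rfl⟩
  obtain ⟨M, hM⟩ : ∃ M : ℚ_[2],
      M = -10125 - 414450 * z - 3525120 * z ^ 2 - 11139072 * z ^ 3 - 12058624 * z ^ 4 := ⟨_, rfl⟩
  have hD1 : ‖D‖ = 1 := by
    refine padic_norm_odd (157 + 1392 * z + 3072 * z ^ 2) ?_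
    rw [hD]
    simp only [map_add, map_mul, map_pow, map_ofNat, padicInt_coe_ringHom_apply]
    ring
  have hA1 : ‖A‖ = 1 := by
    refine padic_norm_odd (562 + 3840 * z + 6656 * z ^ 2) ?_
    rw [hA]
    simp only [map_add, map_mul, map_pow, map_ofNat, padicInt_coe_ringHom_apply]
    ring
  have hM1 : ‖M‖ = 1 := by
    refine padic_norm_odd (-5063 - 207225 * z - 1762560 * z ^ 2 - 5569536 * z ^ 3 - 6029312 * z ^ 4) ?_
    rw [hM]
    simp only [map_sub, map_mul, map_neg, map_pow, map_ofNat, padicInt_coe_ringHom_apply]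
    ring
  have hD0 : D ≠ 0 := norm_ne_zero_iff.1 (by rw [hD1]; norm_num)
  have hM0 : M ≠ 0 := norm_ne_zero_iff.1 (by rw [hM1]; norm_num)
  have hsD : sDen t = 8 * D := by rw [sDen, ht, hD]; ring
  have hs : s t = N / D := by
    rw [s, hsD, show sNum t = 8 * N by rw [sNum, ht, hN]; ring]
    exact mul_div_mul_left _ _ (by norm_num)
  have hkD : kDen (s t) = 128 * M / D ^ 2 := by
    rw [kDen, hs, eq_div_iff (pow_ne_zero _ hD0), sub_mul, div_pow,
      div_mul_cancel₀ _ (pow_ne_zero _ hD0), hN, hD, hM]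
    ring
  have hkN : kNum (s t) = 192 * A ^ 2 / D ^ 2 := by
    have e : s t - 9 = -4 * A / D := by
      rw [hs, eq_div_iff hD0, sub_mul, div_mul_cancel₀ _ hD0, hN, hD, hA]
      ring
    rw [kNum, show s t ^ 2 - 18 * s t + 81 = (s t - 9) ^ 2 by ring, e]
    ring
  have hk : k (s t) = 3 * A ^ 2 / (2 * M) := by
    rw [k, hkD, hkN]
    field_simp
    ring
  have hAM : ∀ c : ℤ_[2], ‖A ^ 4 - 2 * c * M ^ 2‖ = 1 := by
    intro c
    have h1 : ‖A ^ 4‖ = 1 := by rw [norm_pow, hA1, one_pow]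
    have h2 : ‖2 * (c : ℚ_[2]) * M ^ 2‖ < 1 := by
      rw [norm_mul, norm_mul, norm_pow, hM1, padic_norm_two]
      have : ‖(c : ℚ_[2])‖ ≤ 1 := c.2
      linarith
    rw [sub_eq_add_neg, padic_norm_add_eq_left (by rw [norm_neg, h1]; exact h2), h1]
  have hB1 : ‖A ^ 4 - 16 * M ^ 2‖ = 1 := by
    rw [← hAM 8, ← padicInt_coe_ringHom_apply, map_ofNat]; ring_nf
  have hC1 : ‖A ^ 4 - 64 * M ^ 2‖ = 1 := by
    rw [← hAM 32, ← padicInt_coe_ringHom_apply, map_ofNat]; ring_nf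
  have hB0 : A ^ 4 - 16 * M ^ 2 ≠ 0 := norm_ne_zero_iff.1 (by rw [hB1]; norm_num)
  have hrD : rDen (k (s t)) = 27 * (A ^ 4 - 16 * M ^ 2) / (4 * M ^ 2) := by
    rw [rDen, hk]
    field_simp
    ring
  have hr : rOfT t = (A ^ 4 - 64 * M ^ 2) / (3 * (A ^ 4 - 16 * M ^ 2)) := by
    rw [rOfT, r, hrD, rNum, hk]
    field_simp
    ring
  have h3 : ‖(3 : ℚ_[2])‖ = 1 := by
    exact padic_norm_odd 1 (by rw [map_one]; norm_num)
  have hr1 : ‖rOfT t‖ = 1 := by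
    rw [hr, norm_div, norm_mul, hB1, hC1, h3]; norm_num
  have h8 : (8 : ℚ_[2]) ≠ 0 := by norm_num
  have h128 : (128 : ℚ_[2]) ≠ 0 := by norm_num
  have h27 : (27 : ℚ_[2]) ≠ 0 := by norm_num
  have h4 : (4 : ℚ_[2]) ≠ 0 := by norm_num
  refine ⟨⟨?_, ?_, ?_, ?_, ?_⟩, hr1⟩
  · rw [hsD]; exact mul_ne_zero h8 hD0
  · rw [hkD]; exact div_ne_zero (mul_ne_zero h128 hM0) (pow_ne_zero _ hD0)
  · rw [hrD]; exact div_ne_zero (mul_ne_zero h27 hB0) (mul_ne_zero h4 (pow_ne_zero _ hM0))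
  · have e : 1 - 3 * rOfT t = 48 * M ^ 2 / (A ^ 4 - 16 * M ^ 2) := by
      rw [hr, eq_div_iff hB0, sub_mul, mul_div_assoc', mul_div_mul_left _ _ (by norm_num),
        div_mul_cancel₀ _ hB0]
      ring
    rw [e]
    exact div_ne_zero (mul_ne_zero (by norm_num) (pow_ne_zero _ hM0)) hB0
  · exact norm_ne_zero_iff.1 (by rw [hr1]; norm_num)

end Specialization

end SolutionTwo

/-! ### Torsion and independence in the second solution -/

namespace SolutionTwo

section RankThree

/-- The three congruences force torsion subgroup `ℤ/5ℤ` (by the one modulo `128`) and independence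
of the three points (by the other two, which provide the three quadratic characters). -/
lemma members_of_congruences {K : Type*} [Field K] [CharZero K] [DecidableEq K] {t : K}
    (ι₂ : K →+* ℚ_[2]) {z : ℤ_[2]} (h₂ : ι₂ t = 29 + 128 * z)
    (ι₁₇ : K →+* ℚ_[17]) (h₁₇ : ReducesTo (ι₁₇ t) 0)
    (ι₁₉ : K →+* ℚ_[19]) (h₁₉ : ReducesTo (ι₁₉ t) 4) :
    Admissible t ∧ (kubertCurve (rOfT t)).IsElliptic ∧ TorsionIsZMod5 (kubertCurve (rOfT t)) ∧
      HasIndependentPoints (kubertCurve (rOfT t)) (xs t) := by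
  obtain ⟨hadm₂, hu⟩ := padic_unit_rOfT h₂
  have hadm : Admissible t := admissible_of_map ι₂ hadm₂
  rw [← map_rOfT] at hu
  have hE := kubertCurve_isElliptic_of_padic_unit ι₂ hu
  have htor := torsionIsZMod5_of_padic_unit hu
  obtain ⟨r₁, a₀, a₁, a₂⟩ := reducesTo_xs (s₀ := 1) (k₀ := 8) (r₀ := 12) (x₁ := 3) (x₂ := 12)
    (x₃ := 10) h₁₇ (by decide) (by decide) (by decide) (by decide) (by decide) (by decide)
  obtain ⟨r₂, b₀, b₁, b₂⟩ := reducesTo_xs (s₀ := 18) (k₀ := 8) (r₀ := 9) (x₁ := 3) (x₂ := 18)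
    (x₃ := 8) h₁₉ (by decide) (by decide) (by decide) (by decide) (by decide) (by decide)
  rw [← map_rOfT] at r₁ r₂
  rw [← map_xs] at a₀ a₁ a₂ b₀ b₁ b₂
  choose P hP using fun i => exists_hasXCoord (isSquare_kubertCubic_xs hadm i)
  obtain ⟨H₀, d₀, -, n₀⟩ := exists_descent_subgroup htor (by decide) ι₁₇ r₁ (b := 13)
    (by decide) (by decide)
  obtain ⟨H₁, d₁, m₁, n₁⟩ := exists_descent_subgroup htor (by decide) ι₁₇ r₁ (b := 1)
    (by decide) (by decide)
  obtain ⟨H₂, d₂, m₂, n₂⟩ := exists_descent_subgroup htor (by decide) ι₁₉ r₂ (b := 13)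
    (by decide) (by decide)
  exact ⟨hadm, hE, htor, P, hP, linearIndependent_of_subgroups
    (fun _ => eq_zero_of_two_nsmul_eq_zero htor) P H₀ H₁ H₂ d₀ d₁ d₂
    (n₀ _ _ _ (hP 0) a₀ (by decide))
    (m₁ _ _ _ 6 (hP 0) a₀ (by decide) (by decide)) (n₁ _ _ _ (hP 1) a₁ (by decide))
    (m₂ _ _ _ 3 (hP 0) b₀ (by decide) (by decide)) (m₂ _ _ _ 9 (hP 1) b₁ (by decide) (by decide))
    (n₂ _ _ _ (hP 2) b₂ (by decide))⟩

lemma isGenericRankThreeFamily [DecidableEq (RatFunc ℚ)] :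
    IsGenericRankThreeFamily (rOfT RatFunc.X) (xs RatFunc.X) := by
  obtain ⟨ι₂, z₂, h₂⟩ := exists_ratFunc_embedding 2 29 7
  obtain ⟨ι₁₇, z₁₇, h₁₇⟩ := exists_ratFunc_embedding 17 0 1
  obtain ⟨ι₁₉, z₁₉, h₁₉⟩ := exists_ratFunc_embedding 19 4 1
  obtain ⟨-, hE, htor, hind⟩ := members_of_congruences ι₂ (z := z₂) (by rw [h₂]; norm_num)
    ι₁₇ (by simpa using reducesTo_of_eq h₁₇) ι₁₉ (by simpa using reducesTo_of_eq h₁₉)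
  exact ⟨hE, htor, hind, three_le_rank_of_hasIndependentPoints hind⟩

lemma everyMemberHasPoints : EveryMemberHasPoints Admissible rOfT xs :=
  everyMemberHasPoints_of_isSquare (fun _ ht => ht.2.2.2.2)
    fun _ ht => isSquare_kubertCubic_xs ht

lemma finite_fibre_rOfT (r₀ : ℚ) : {t : ℚ | Admissible t ∧ rOfT t = r₀}.Finite := by
  have hr : ∀ v : ℚ, {k : ℚ | rDen k ≠ 0 ∧ rNum k / rDen k = v}.Finite := fun v =>
    finite_fibre_of_quadratic (a := 1 - 3 * v) (b := 0) (c := 108 * v - 144)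
      (by by_cases h : v = 1 / 3 <;> [(right; right); left] <;> grind)
      (fun k => by rw [rNum, rDen]; ring)
  have hk : ∀ v : ℚ, {s : ℚ | kDen s ≠ 0 ∧ kNum s / kDen s = v}.Finite := fun v =>
    finite_fibre_of_quadratic (a := 12 - v) (b := -216) (c := 972 + 41 * v) (by norm_num)
      (fun s => by rw [kNum, kDen]; ring)
  have hs : ∀ v : ℚ, {t : ℚ | sDen t ≠ 0 ∧ sNum t / sDen t = v}.Finite := fun v =>
    finite_fibre_of_quadratic (a := 1 - 3 * v) (b := -412) (c := 3 * v - 2213) (by norm_num)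
      (fun t => by rw [sNum, sDen]; ring)
  refine ((hr r₀).biUnion fun k _ => (hk k).biUnion fun s _ => hs s).subset ?_
  rintro t ⟨⟨h₁, h₂, h₃, -⟩, h⟩
  simp only [Set.mem_iUnion]
  exact ⟨k (s t), ⟨h₃, h⟩, s t, ⟨h₂, rfl⟩, h₁, rfl⟩

lemma infinitelyManyRankThreeMembers : InfinitelyManyRankThreeMembers Admissible rOfT xs := by
  -- An arithmetic progression inside the classes `29` mod `128`, `0` mod `17` and `4` mod `19`.
  refine infinitelyManyRankThreeMembers_of_injective (t := fun n : ℕ => 27421 + 41344 * (n : ℚ))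
    (fun m n h => by simpa using h) finite_fibre_rOfT fun n => ?_
  refine members_of_congruences (Rat.castHom ℚ_[2]) (z := ((214 + 323 * n : ℕ) : ℤ_[2])) ?_
    (Rat.castHom ℚ_[17]) ?_ (Rat.castHom ℚ_[19]) ?_
  · rw [PadicInt.coe_natCast]
    simp only [map_add, map_mul, map_ofNat, map_natCast]
    push_cast
    ring
  · refine reducesTo_of_eq (c := 0) (z := ((1613 + 2432 * n : ℕ) : ℤ_[17])) ?_
    rw [PadicInt.coe_natCast]
    simp only [map_add, map_mul, map_ofNat, map_natCast]
    push_cast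
    ring
  · refine reducesTo_of_eq (c := 4) (z := ((1443 + 2176 * n : ℕ) : ℤ_[19])) ?_
    rw [PadicInt.coe_natCast]
    simp only [map_add, map_mul, map_ofNat, map_natCast]
    push_cast
    ring

end RankThree

end SolutionTwo

/-! ### Both solutions together -/

theorem mainTheorem7 [DecidableEq (RatFunc ℚ)] :
    -- first solution: the three conics and their parametrizations
    ((IsSquareTimesQuadratic
        (kubertCubic RatFunc.X (SolutionOne.x RatFunc.X)) 1 (-15) 36 ∧
      ParametrizesConic 1 (-15) 36 {3} SolutionOne.rNum SolutionOne.rDen) ∧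
     (IsSquareTimesQuadratic
        (kubertCubic (SolutionOne.r RatFunc.X) (SolutionOne.xOfU RatFunc.X)) 17 (-16) 0 ∧
      ParametrizesConic 17 (-16) 0 ∅ SolutionOne.kNum SolutionOne.kDen) ∧
     (IsSquareTimesQuadratic
        (kubertCubic (SolutionOne.r (SolutionOne.k RatFunc.X)) (SolutionOne.xOfH RatFunc.X))
        33 (-34) (-255) ∧
      ParametrizesConic 33 (-34) (-255) ∅ SolutionOne.sNum SolutionOne.sDen) ∧
     -- first solution: the family
     IsGenericRankThreeFamily (SolutionOne.rOfT RatFunc.X) (SolutionOne.xs RatFunc.X) ∧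
     EveryMemberHasPoints SolutionOne.Admissible SolutionOne.rOfT SolutionOne.xs ∧
     InfinitelyManyRankThreeMembers SolutionOne.Admissible SolutionOne.rOfT SolutionOne.xs) ∧
    -- second solution: the three conics and their parametrizations
    ((IsSquareTimesQuadratic
        (kubertCubic RatFunc.X (SolutionTwo.x RatFunc.X)) 9 (-15) 4 ∧
      ParametrizesConic 9 (-15) 4 {1 / 3} SolutionTwo.rNum SolutionTwo.rDen) ∧
     (IsSquareTimesQuadratic
        (kubertCubic (SolutionTwo.r RatFunc.X) (SolutionTwo.xOfU RatFunc.X)) 41 480 0 ∧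
      ParametrizesConic 41 480 0 ∅ SolutionTwo.kNum SolutionTwo.kDen) ∧
     (IsSquareTimesQuadratic
        (kubertCubic (SolutionTwo.r (SolutionTwo.k RatFunc.X)) (SolutionTwo.xOfH RatFunc.X))
        1 (-738) 4961 ∧
      ParametrizesConic 1 (-738) 4961 ∅ SolutionTwo.sNum SolutionTwo.sDen) ∧
     -- second solution: the family
     IsGenericRankThreeFamily (SolutionTwo.rOfT RatFunc.X) (SolutionTwo.xs RatFunc.X) ∧
     EveryMemberHasPoints SolutionTwo.Admissible SolutionTwo.rOfT SolutionTwo.xs ∧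
     InfinitelyManyRankThreeMembers SolutionTwo.Admissible SolutionTwo.rOfT SolutionTwo.xs) :=
  ⟨⟨⟨SolutionOne.isSquareTimesQuadratic_r, SolutionOne.parametrizesConic_r⟩,
    ⟨SolutionOne.isSquareTimesQuadratic_k, SolutionOne.parametrizesConic_k⟩,
    ⟨SolutionOne.isSquareTimesQuadratic_s, SolutionOne.parametrizesConic_s⟩,
    SolutionOne.isGenericRankThreeFamily, SolutionOne.everyMemberHasPoints,
    SolutionOne.infinitelyManyRankThreeMembers⟩,
   ⟨⟨SolutionTwo.isSquareTimesQuadratic_r, SolutionTwo.parametrizesConic_r⟩,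
    ⟨SolutionTwo.isSquareTimesQuadratic_k, SolutionTwo.parametrizesConic_k⟩,
    ⟨SolutionTwo.isSquareTimesQuadratic_s, SolutionTwo.parametrizesConic_s⟩,
    SolutionTwo.isGenericRankThreeFamily, SolutionTwo.everyMemberHasPoints,
    SolutionTwo.infinitelyManyRankThreeMembers⟩⟩
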